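/- Let $G\subset\mathbb R^3$ be a bounded open set with $C^\infty$ boundary and strictly convex closure $\overline G$, with unit outward normal $\nu$. Let $S\subset\mathbb R^3$ be the unit sphere, $I=[E_0,E_m]$ with $0\le E_0<E_m<\infty$, $I^\circ=\,]E_0,E_m[$, and let $m\in\mathbb N_0$. All functions are real valued, $L^p(G\times S\times I)$ refers to $dx\,d\omega\,dE$, and $$\Gamma_{\mp}=\{(y,\omega,E)\in\partial G\times S\times I:\ \pm\,\omega\cdot\nu(y)<0\},\qquad \Gamma_0=\{(y,\omega,E)\in\partial G\times S\times I:\ \omega\cdot\nu(y)=0\}.$$ *Spaces.* For $k\in\mathbb N_0\cup\{\infty\}$ let $C_0^{(k,0,0)}(\mathbb R^3\times S\times\mathbb R)$ be the compactly supported functions all of whose partial derivatives $\partial_x^\alpha$, $|\alpha|\le k$, exist and are continuous on $\mathbb R^3\times S\times\mathbb R$, and let $C^{(k,0,0)}(\overline G\times S\times I)$ be the set of their restrictions to $G\times S\times I^\circ$. Let $\mathcal D$ be the set of all $\psi\in\bigcap_{k\ge1}C^{(k,0,0)}(\overline G\times S\times I)$ whose support in $\overline G\times S\times I$ does not meet $\Gamma_-\cup\Gamma_0$.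 Let $H_0^{(m,0,0)}=H_0^{(m,0,0)}(G\times S\times I,\Gamma_-)$ be the completion of $\mathcal D$ for the inner product $\sum_{|\alpha|\le m}\langle\partial_x^\alpha\psi,\partial_x^\alpha v\rangle_{L^2(G\times S\times I)}$, and let $\mathcal W^{\infty,(m,0,0)}=\mathcal W^{\infty,(m,0,0)}(G\times S\times I)$ be the completion of $C^{(\infty,0,0)}(\overline G\times S\times I)$ for the norm $\|\Sigma\|=\max_{|\alpha|\le m}\|\partial_x^\alpha\Sigma\|_{L^\infty(G\times S\times I)}$. *The constant.* There is a constant $c(m)>0$, depending only on $m$, such that for all $\Sigma\in\mathcal W^{\infty,(m,0,0)}$ and $\psi\in H_0^{(m,0,0)}$ the product $\Sigma\psi$ belongs to $H_0^{(m,0,0)}$ and $$\|\Sigma\psi\|_{H_0^{(m,0,0)}}\le c(m)\,\|\Sigma\|\,\|\psi\|_{H_0^{(m,0,0)}}.\tag{1}$$ *The operator.* Let $\Sigma\in\mathcal W^{\infty,(m,0,0)}$. The operator $P_m\psi=\omega\cdot\nabla_x\psi+\Sigma\psi$ with domain $D(P_m)=\mathcal D$ maps into $H_0^{(m,0,0)}$,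 and the closure of its graph in $H_0^{(m,0,0)}\times H_0^{(m,0,0)}$ is the graph of a (single-valued) operator $\widetilde P_m$. **Theorem.** Let $c(m)>0$ be any constant for which (1) holds for all $\Sigma\in\mathcal W^{\infty,(m,0,0)}$ and $\psi\in H_0^{(m,0,0)}$. Let $\Sigma\in\mathcal W^{\infty,(m,0,0)}$ and $C'=c(m)\|\Sigma\|$. Then for every $C>C'$ $$R(\widetilde P_m+C\,\mathcal I)=H_0^{(m,0,0)}(G\times S\times I,\Gamma_-),$$ and for every $f\in H_0^{(m,0,0)}$ there is a unique strong solution of $$\omega\cdot\nabla_x\psi+\Sigma\psi+C\psi=f,\qquad \psi_{|\Gamma_-}=0,$$ that is, a unique $\psi\in D(\widetilde P_m)\subset H_0^{(m,0,0)}$ with $(\widetilde P_m+C\,\mathcal I)\psi=f$. This $\psi$ satisfies the equation and the inflow condition in the weak sense: $$\int_{G\times S\times I}(f-\Sigma\psi-C\psi)\,\varphi\;dx\,d\omega\,dE=-\int_{G\times S\times I}\psi\;\omega\cdot\nabla_x\varphi\;dx\,d\omega\,dE$$ for all $\varphi\in C^{(1,0,0)}(\overline G\times S\times I)$ whose support in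 $\overline G\times S\times I$ does not meet $\Gamma_+\cup\Gamma_0$. -/

import Mathlib

open MeasureTheory Set Filter Topology
open scoped ENNReal ContDiff

noncomputable section

namespace Transport

/-- Euclidean three-space. -/
abbrev V3 : Type := EuclideanSpace ℝ (Fin 3)

/-- The unit sphere `S` of three-space. -/
abbrev Sph : Type := Metric.sphere (0 : V3) 1

/-- The ambient phase space `ℝ³ × S × ℝ`, with points `(x, ω, E)`. -/
abbrev Phase : Type := V3 × Sph × ℝ

/-! ### The domain -/

/-- `ρ` is a smooth local defining function of `G` at `y`: the gradient of `ρ` does not vanish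
at `y`, and `G = {ρ < 0}` near `y`. -/
def IsLocalDefiningFunction (G : Set V3) (y : V3) (ρ : V3 → ℝ) : Prop :=
  ContDiff ℝ ∞ ρ ∧ gradient ρ y ≠ 0 ∧ ∀ᶠ x in 𝓝 y, (x ∈ G ↔ ρ x < 0)

/-- `G` is open and bounded with a `C^∞` boundary, and its closure is strictly convex. -/
structure IsSmoothStrictlyConvexDomain (G : Set V3) : Prop where
  isOpen : IsOpen G
  isBounded : Bornology.IsBounded G
  smooth_boundary : ∀ y ∈ frontier G, ∃ ρ : V3 → ℝ, IsLocalDefiningFunction G y ρ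
  strictConvex : StrictConvex ℝ (closure G)

/-- `n` is the unit outward normal of `G` at the boundary point `y`. -/
def IsOutwardNormal (G : Set V3) (y n : V3) : Prop :=
  ∃ ρ : V3 → ℝ, IsLocalDefiningFunction G y ρ ∧ n = ‖gradient ρ y‖⁻¹ • gradient ρ y

/-- `Γ₋ ∪ Γ₀`: the boundary points `(y, ω, E)`, `y ∈ ∂G`, `E ∈ [E₀, Eₘ]`, with `ω · ν(y) ≤ 0`. -/
def gammaMinusZero (G : Set V3) (E₀ Eₘ : ℝ) : Set Phase :=
  {z | z.1 ∈ frontier G ∧ z.2.2 ∈ Icc E₀ Eₘ ∧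
    ∃ n, IsOutwardNormal G z.1 n ∧ inner ℝ (z.2.1 : V3) n ≤ 0}

/-- `Γ₊ ∪ Γ₀`: the boundary points `(y, ω, E)`, `y ∈ ∂G`, `E ∈ [E₀, Eₘ]`, with `ω · ν(y) ≥ 0`. -/
def gammaPlusZero (G : Set V3) (E₀ Eₘ : ℝ) : Set Phase :=
  {z | z.1 ∈ frontier G ∧ z.2.2 ∈ Icc E₀ Eₘ ∧
    ∃ n, IsOutwardNormal G z.1 n ∧ 0 ≤ inner ℝ (z.2.1 : V3) n}

/-- `G × S × I°`, where `I° = ]E₀, Eₘ[`. -/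
def phaseInterior (G : Set V3) (E₀ Eₘ : ℝ) : Set Phase :=
  {z | z.1 ∈ G ∧ z.2.2 ∈ Ioo E₀ Eₘ}

/-- The measure `dx dω dE` on `G × S × I`, where `I = [E₀, Eₘ]` and `dω` is the surface measure
of the sphere. -/
def phaseMeasure (G : Set V3) (E₀ Eₘ : ℝ) : Measure Phase :=
  ((volume : Measure V3).restrict G).prod
    ((volume : Measure V3).toSphere.prod ((volume : Measure ℝ).restrict (Icc E₀ Eₘ)))

/-! ### Functions that are smooth in the space variable -/

/-- The partial derivative `∂f/∂xᵢ`. -/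
def pd (i : Fin 3) (f : Phase → ℝ) : Phase → ℝ := fun z =>
  lineDeriv ℝ (fun x => f (x, z.2)) z.1 (EuclideanSpace.single i 1)

/-- The derivative `∂ₓ^α f` for a multi-index `α`. -/
def pdMulti (α : Fin 3 → ℕ) (f : Phase → ℝ) : Phase → ℝ :=
  (pd 0)^[α 0] ((pd 1)^[α 1] ((pd 2)^[α 2] f))

/-- The streaming term `ω · ∇ₓ f`. -/
def advect (f : Phase → ℝ) : Phase → ℝ := fun z => ∑ i, (z.2.1 : V3) i * pd i f z

/-- `f ∈ C^{(k,0,0)}(ℝ³ × S × ℝ)`: all partial derivatives of `f` in `x` of order at most `k`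
exist and are continuous on `ℝ³ × S × ℝ`. -/
def IsCx : ℕ → (Phase → ℝ) → Prop
  | 0, f => Continuous f
  | k + 1, f => Continuous f ∧ ∀ i : Fin 3,
      (∀ z : Phase,
        LineDifferentiableAt ℝ (fun x => f (x, z.2)) z.1 (EuclideanSpace.single i 1)) ∧
      IsCx k (pd i f)

/-- `f ∈ C₀^{(k,0,0)}(ℝ³ × S × ℝ)`: in addition the support of `f` is compact. -/
def IsCxCompact (k : ℕ) (f : Phase → ℝ) : Prop := IsCx k f ∧ HasCompactSupport f

/-- `ψ ∈ C₀^{(k,0,0)}(Ḡ × S × I, Γ₋)`: on `G × S × I°` the function `ψ` is the restriction of an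
element of `C₀^{(k,0,0)}(ℝ³ × S × ℝ)`, and the support of `ψ` in `Ḡ × S × I` does not meet
`Γ₋ ∪ Γ₀`. The values of `ψ` outside `G × S × I°` play no role. -/
def IsInflowVanishing (G : Set V3) (E₀ Eₘ : ℝ) (k : ℕ) (ψ : Phase → ℝ) : Prop :=
  (∃ f, IsCxCompact k f ∧ EqOn ψ f (phaseInterior G E₀ Eₘ)) ∧
    Disjoint (closure (Function.support ψ ∩ phaseInterior G E₀ Eₘ)) (gammaMinusZero G E₀ Eₘ)

/-- The intersection of the spaces `C₀^{(k,0,0)}(Ḡ × S × I, Γ₋)` over all `k ≥ 1`. -/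
def smoothSpace (G : Set V3) (E₀ Eₘ : ℝ) : Set (Phase → ℝ) :=
  {ψ | ∀ k : ℕ, 1 ≤ k → IsInflowVanishing G E₀ Eₘ k ψ}

/-! ### The function spaces -/

/-- Multi-indices `α ∈ ℕ₀³` with `|α| ≤ m`. -/
abbrev MultiIndex (m : ℕ) : Type := {α : Fin 3 → Fin (m + 1) // ∑ i, (α i : ℕ) ≤ m}

/-- The multi-index zero. -/
def zeroIndex (m : ℕ) : MultiIndex m := ⟨fun _ => 0, by simp⟩

/-- Families `(u_α)`, `|α| ≤ m`, in `L²(G × S × I)`, with the Hilbert space norm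
`‖u‖² = ∑_α ‖u_α‖²`. An element `ψ` of `H^{(m,0,0)}(G × S × I)` is represented isometrically by the
family `(∂ₓ^α ψ)`; the function itself is the component with index zero. -/
abbrev L2Jet (m : ℕ) (G : Set V3) (E₀ Eₘ : ℝ) : Type :=
  PiLp 2 (fun _ : MultiIndex m => Lp ℝ 2 (phaseMeasure G E₀ Eₘ))

/-- Families `(s_α)`, `|α| ≤ m`, in `L^∞(G × S × I)`, with the norm `‖s‖ = max_α ‖s_α‖`. An element
`Σ` of `W^{∞,(m,0,0)}(G × S × I)` is represented by the family `(∂ₓ^α Σ)`. -/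
abbrev LinftyJet (m : ℕ) (G : Set V3) (E₀ Eₘ : ℝ) : Type :=
  MultiIndex m → Lp ℝ ∞ (phaseMeasure G E₀ Eₘ)

/-- `u` is the family of the derivatives `∂ₓ^α ψ`, `|α| ≤ m`. -/
def IsL2Jet {m : ℕ} {G : Set V3} {E₀ Eₘ : ℝ} (ψ : Phase → ℝ) (u : L2Jet m G E₀ Eₘ) : Prop :=
  ∀ α : MultiIndex m, u α =ᵐ[phaseMeasure G E₀ Eₘ] pdMulti (fun i => (α.1 i : ℕ)) ψ

/-- `s` is the family of the derivatives `∂ₓ^α ϕ`, `|α| ≤ m`. -/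
def IsLinftyJet {m : ℕ} {G : Set V3} {E₀ Eₘ : ℝ} (ϕ : Phase → ℝ) (s : LinftyJet m G E₀ Eₘ) :
    Prop :=
  ∀ α : MultiIndex m, s α =ᵐ[phaseMeasure G E₀ Eₘ] pdMulti (fun i => (α.1 i : ℕ)) ϕ

/-- The space `H₀^{(m,0,0)}(G × S × I, Γ₋)`: the completion of `smoothSpace` for the inner product
`∑_{|α| ≤ m} ⟨∂ₓ^α ψ, ∂ₓ^α v⟩`, realized as a closure in the complete space `L2Jet`. -/
def H0 (m : ℕ) (G : Set V3) (E₀ Eₘ : ℝ) : Set (L2Jet m G E₀ Eₘ) :=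
  closure {u | ∃ ψ ∈ smoothSpace G E₀ Eₘ, IsL2Jet ψ u}

/-- The space `𝒲^{∞,(m,0,0)}(G × S × I)`: the completion of `C^{(∞,0,0)}(Ḡ × S × I)` (the
restrictions of the compactly supported `C^{(∞,0,0)}` functions on `ℝ³ × S × ℝ`) for the norm of
`W^{∞,(m,0,0)}`. -/
def coeffSpace (m : ℕ) (G : Set V3) (E₀ Eₘ : ℝ) : Set (LinftyJet m G E₀ Eₘ) :=
  closure {s | ∃ ϕ : Phase → ℝ, (∀ k, IsCxCompact k ϕ) ∧ IsLinftyJet ϕ s}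

/-- Multiplication by elements of `𝒲^{∞,(m,0,0)}` maps `H₀^{(m,0,0)}` to itself, with
`‖Σ ψ‖ ≤ c ‖Σ‖ ‖ψ‖`. -/
def MultiplicationBound (m : ℕ) (G : Set V3) (E₀ Eₘ c : ℝ) : Prop :=
  ∀ s ∈ coeffSpace m G E₀ Eₘ, ∀ u ∈ H0 m G E₀ Eₘ, ∃ g ∈ H0 m G E₀ Eₘ,
    (g (zeroIndex m) =ᵐ[phaseMeasure G E₀ Eₘ]
      fun z => s (zeroIndex m) z * u (zeroIndex m) z) ∧
    ‖g‖ ≤ c * ‖s‖ * ‖u‖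

/-! ### The transport operator -/

/-- The graph of the operator `P_m ψ = ω · ∇ₓ ψ + Σ ψ` in `H₀^{(m,0,0)}`, whose domain is
`smoothSpace`. -/
def transportGraph {m : ℕ} {G : Set V3} {E₀ Eₘ : ℝ} (s : LinftyJet m G E₀ Eₘ) :
    Set (L2Jet m G E₀ Eₘ × L2Jet m G E₀ Eₘ) :=
  {p | ∃ ψ ∈ smoothSpace G E₀ Eₘ, IsL2Jet ψ p.1 ∧ p.2 ∈ H0 m G E₀ Eₘ ∧
    p.2 (zeroIndex m) =ᵐ[phaseMeasure G E₀ Eₘ]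
      fun z => advect ψ z + s (zeroIndex m) z * ψ z}

/-- The graph of the smallest closed extension of `P_m`. -/
def closedTransportGraph {m : ℕ} {G : Set V3} {E₀ Eₘ : ℝ} (s : LinftyJet m G E₀ Eₘ) :
    Set (L2Jet m G E₀ Eₘ × L2Jet m G E₀ Eₘ) :=
  closure (transportGraph s)

/-- `u` is a strong solution of `ω · ∇ₓ ψ + Σ ψ + C ψ = f`, `ψ = 0` on `Γ₋`: it lies in the domain
of the closed operator, and its image under that operator is `f - C u`. -/
def IsStrongSolution {m : ℕ} {G : Set V3} {E₀ Eₘ : ℝ} (s : LinftyJet m G E₀ Eₘ) (C : ℝ)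
    (f u : L2Jet m G E₀ Eₘ) : Prop :=
  (u, f - C • u) ∈ closedTransportGraph s

/-- The equation `ω · ∇ₓ ψ + Σ ψ + C ψ = f` and the inflow condition `ψ = 0` on `Γ₋`, in the
weak sense of Green's formula: the test functions are arbitrary near `Γ₋` and vanish
near `Γ₊ ∪ Γ₀`. -/
def SolvesInflowProblem {m : ℕ} {G : Set V3} {E₀ Eₘ : ℝ} (s : LinftyJet m G E₀ Eₘ) (C : ℝ)
    (f u : L2Jet m G E₀ Eₘ) : Prop :=
  ∀ φ : Phase → ℝ, IsCxCompact 1 φ →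
    Disjoint (closure (Function.support φ ∩ phaseInterior G E₀ Eₘ)) (gammaPlusZero G E₀ Eₘ) →
    ∫ z, (f (zeroIndex m) z - s (zeroIndex m) z * u (zeroIndex m) z - C * u (zeroIndex m) z) * φ z
        ∂(phaseMeasure G E₀ Eₘ) =
      -∫ z, u (zeroIndex m) z * advect φ z ∂(phaseMeasure G E₀ Eₘ)

end Transport

end

noncomputable section

namespace Transport

/-! ### Functions with continuous partial derivatives -/

/-! Let A be the closure of the streaming operator ω·∇ₓ on 𝒟. The plan is to show that A is
accretive and that A + C is onto H₀ for every C > 0, and then to add the bounded multiplication by Σ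
through a contraction argument.

Accretivity comes from translations along characteristics instead of boundary integrals. Near an
outgoing boundary point no characteristic enters G from outside, by convexity. Hence ψ ∈ 𝒟 has an
extension f that vanishes on the backward shadow, the set of points outside G from which G is
reached by going forward (`IsInflowVanishing.exists_extension`). Then ∫_G f(x - hω)² ≤ ∫_G f² for h
≥ 0, and differentiating at h = 0 gives 0 ≤ ∫ ψ ω·∇ₓψ (`integral_mul_advect_nonneg`). Since ∂ₓ^α
commutes with ω·∇ₓ and maps 𝒟 to itself, the same inequality holds for every derivative, and so for
the inner product of H₀ (`inner_nonneg_of_mem_closedStreamGraph`).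

For smooth data f the function ∫₀^∞ e^{-Ct} f(x - tω, ω, E) dt solves the equation with Σ = 0. It
belongs to 𝒟 because, by strict convexity, a point of the closed domain carried forward for a
positive time cannot land on Γ₋ ∪ Γ₀ (`exists_smooth_solution`). Accretivity bounds A + C from
below, so its range is closed, and it contains the dense set 𝒟 (`exists_mem_closedStreamGraph`).

Multiplication by Σ acts on jets through the Leibniz formula, as a bounded bilinear map `jetMul`. An
element of H₀ is determined by its component of index zero, because the other components are its
weak derivatives (`eq_zero_of_apply_zeroIndex`). Therefore `jetMul` is the product in (1), every
admissible c bounds it, and the graph of P_m is the image of the streaming graph under a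
homeomorphic shear. The inverse R of A + C has Lipschitz constant at most 1/C, so u ↦ R(f - Σu) is a
contraction when c‖Σ‖ < C; the same estimates give uniqueness. Green's formula, passed to the limit,
gives the weak form of the problem and the single-valuedness of the closure
(`integral_mul_of_mem_closedStreamGraph`). -/

/-- The standard basis vectors of three-space. -/
abbrev basisVec (i : Fin 3) : V3 := EuclideanSpace.single i 1

/-- A function on three-space with continuous partial derivatives is differentiable. -/
theorem hasFDerivAt_of_continuous_partials {g : V3 → ℝ} {g' : Fin 3 → V3 → ℝ}
    (hc : ∀ i, Continuous (g' i)) (hd : ∀ i x, HasLineDerivAt ℝ g (g' i x) x (basisVec i)) (x : V3) :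
    HasFDerivAt g (∑ i, g' i x • (EuclideanSpace.proj i : V3 →L[ℝ] ℝ)) x := by
  -- Coordinates (a, (b, c)): the two-variable criterion for differentiability is applied twice,
  -- first in (b, c) with a fixed and then to a against the pair (b, c).
  let P : ℝ × ℝ × ℝ →L[ℝ] V3 :=
    (ContinuousLinearMap.fst ℝ ℝ (ℝ × ℝ)).smulRight (basisVec 0) +
      (((ContinuousLinearMap.fst ℝ ℝ ℝ).comp (ContinuousLinearMap.snd ℝ ℝ (ℝ × ℝ))).smulRight
        (basisVec 1) +
       ((ContinuousLinearMap.snd ℝ ℝ ℝ).comp (ContinuousLinearMap.snd ℝ ℝ (ℝ × ℝ))).smulRight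
        (basisVec 2))
  have hP : ∀ a b c, P (a, b, c) = a • basisVec 0 + (b • basisVec 1 + c • basisVec 2) :=
    fun a b c => by simp [P]
  have hpart : ∀ i x, ∀ (p : ℝ → V3) (t : ℝ), p t = x → (∀ s, p s = x + (s - t) • basisVec i) →
      HasFDerivAt (fun s => g (p s)) (ContinuousLinearMap.toSpanSingleton ℝ (g' i x)) t := by
    intro i x p t _ hp
    have h := hd i x
    unfold HasLineDerivAt at h
    have h2 : HasDerivAt (fun s : ℝ => s - t) 1 t := (hasDerivAt_id t).sub_const t
    have h3 : HasDerivAt (fun s => g (x + (s - t) • basisVec i)) (g' i x * 1) t := by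
      refine HasDerivAt.comp t (h₂ := fun s : ℝ => g (x + s • basisVec i)) ?_ h2
      simpa using h
    simp only [mul_one] at h3
    have h4 : (fun s => g (p s)) = fun s => g (x + (s - t) • basisVec i) := by
      funext s; rw [hp]
    rw [h4]
    exact h3.hasFDerivAt
  have hspan : Continuous fun r : ℝ => ContinuousLinearMap.toSpanSingleton ℝ r :=
    (ContinuousLinearMap.toSpanSingletonLE ℝ ℝ ℝ).toLinearMap.continuous_of_finiteDimensional
  have hbc : ∀ a (v : ℝ × ℝ), HasFDerivAt (fun v : ℝ × ℝ => g (P (a, v)))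
      ((ContinuousLinearMap.toSpanSingleton ℝ (g' 1 (P (a, v)))).coprod
        (ContinuousLinearMap.toSpanSingleton ℝ (g' 2 (P (a, v))))) v := by
    intro a v
    have := hasStrictFDerivAt_uncurry_coprod (𝕜 := ℝ) (u := v) (f := fun b c => g (P (a, b, c)))
      (f₁ := fun b c => ContinuousLinearMap.toSpanSingleton ℝ (g' 1 (P (a, b, c))))
      (f₂ := fun b c => ContinuousLinearMap.toSpanSingleton ℝ (g' 2 (P (a, b, c))))
      (.of_forall fun w => hpart 1 _ _ _ rfl fun s => by simp only [hP]; module)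
      (.of_forall fun w => hpart 2 _ _ _ rfl fun s => by simp only [hP]; module)
      (hspan.comp ((hc 1).comp (P.continuous.comp
        (by fun_prop : Continuous fun v : ℝ × ℝ => (a, v.1, v.2))))).continuousAt
      (hspan.comp ((hc 2).comp (P.continuous.comp
        (by fun_prop : Continuous fun v : ℝ × ℝ => (a, v.1, v.2))))).continuousAt
    exact this.hasFDerivAt
  have hcop : Continuous fun r : (ℝ →L[ℝ] ℝ) × (ℝ →L[ℝ] ℝ) => r.1.coprod r.2 :=
    (ContinuousLinearMap.coprodEquivL (𝕜 := ℝ) (S := ℝ) (E := ℝ) (F := ℝ) (G := ℝ)).continuous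
  have habc : ∀ w : ℝ × ℝ × ℝ, HasFDerivAt (fun w : ℝ × ℝ × ℝ => g (P w))
      ((ContinuousLinearMap.toSpanSingleton ℝ (g' 0 (P w))).coprod
        ((ContinuousLinearMap.toSpanSingleton ℝ (g' 1 (P w))).coprod
        (ContinuousLinearMap.toSpanSingleton ℝ (g' 2 (P w))))) w := by
    intro w
    have := hasStrictFDerivAt_uncurry_coprod (𝕜 := ℝ) (u := w) (f := fun a v => g (P (a, v)))
      (f₁ := fun a v => ContinuousLinearMap.toSpanSingleton ℝ (g' 0 (P (a, v))))
      (f₂ := fun a v => (ContinuousLinearMap.toSpanSingleton ℝ (g' 1 (P (a, v)))).coprod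
        (ContinuousLinearMap.toSpanSingleton ℝ (g' 2 (P (a, v)))))
      (.of_forall fun w => hpart 0 _ _ _ rfl fun s => by
        obtain ⟨a, b, c⟩ := w; simp only [hP]; module)
      (.of_forall fun w => hbc _ _)
      (hspan.comp ((hc 0).comp (P.continuous.comp
        (by fun_prop : Continuous fun v : ℝ × ℝ × ℝ => (v.1, v.2))))).continuousAt
      (hcop.comp (((hspan.comp ((hc 1).comp (P.continuous.comp
        (by fun_prop : Continuous fun v : ℝ × ℝ × ℝ => (v.1, v.2)))))).prodMk
        (hspan.comp ((hc 2).comp (P.continuous.comp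
        (by fun_prop : Continuous fun v : ℝ × ℝ × ℝ => (v.1, v.2))))))).continuousAt
    exact this.hasFDerivAt
  let Q : V3 →L[ℝ] ℝ × ℝ × ℝ := (EuclideanSpace.proj 0).prod
    ((EuclideanSpace.proj 1).prod (EuclideanSpace.proj 2))
  have hPQ : ∀ y, P (Q y) = y := by
    intro y
    have : Q y = (y 0, y 1, y 2) := rfl
    rw [this, hP]
    ext i; fin_cases i <;> simp
  have h5 := (habc (Q x)).comp x Q.hasFDerivAt
  have h6 : ((fun w : ℝ × ℝ × ℝ => g (P w)) ∘ Q) = g := by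
    funext y; simp only [Function.comp, hPQ]
  rw [h6] at h5
  rw [hPQ] at h5
  refine h5.congr_fderiv ?_
  ext y
  simp [Fin.sum_univ_three, Q, mul_comm]
  ring

/-! ### The calculus of functions that are smooth in the space variable -/

theorem IsCx.continuous {k : ℕ} {f : Phase → ℝ} (hf : IsCx k f) : Continuous f := by
  cases k with
  | zero => exact hf
  | succ k => exact hf.1

theorem IsCx.pd {k : ℕ} {f : Phase → ℝ} (hf : IsCx (k + 1) f) (i : Fin 3) : IsCx k (pd i f) :=
  (hf.2 i).2

theorem IsCx.pred {k : ℕ} {f : Phase → ℝ} (hf : IsCx (k + 1) f) : IsCx k f := by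
  induction k generalizing f with
  | zero => exact hf.continuous
  | succ k ih => exact ⟨hf.continuous, fun i => ⟨(hf.2 i).1, ih (hf.pd i)⟩⟩

theorem IsCx.mono {k l : ℕ} {f : Phase → ℝ} (hf : IsCx k f) (h : l ≤ k) : IsCx l f := by
  induction k, h using Nat.le_induction with
  | base => exact hf
  | succ k _ ih => exact ih hf.pred

theorem IsCx.hasLineDerivAt {k : ℕ} {f : Phase → ℝ} (hf : IsCx (k + 1) f) (i : Fin 3) (x : V3)
    (p : Sph × ℝ) : HasLineDerivAt ℝ (fun x => f (x, p)) (Transport.pd i f (x, p)) x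
      (basisVec i) :=
  ((hf.2 i).1 (x, p)).hasLineDerivAt

theorem IsCx.of_hasLineDerivAt {k : ℕ} {f : Phase → ℝ} {g : Fin 3 → Phase → ℝ}
    (hf : Continuous f)
    (hd : ∀ i x p, HasLineDerivAt ℝ (fun x => f (x, p)) (g i (x, p)) x (basisVec i))
    (hg : ∀ i, IsCx k (g i)) : IsCx (k + 1) f := by
  refine ⟨hf, fun i => ⟨fun z => (hd i z.1 z.2).lineDifferentiableAt, ?_⟩⟩
  have : Transport.pd i f = g i := funext fun z => (hd i z.1 z.2).lineDeriv
  rw [this]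
  exact hg i

theorem IsCx.hasFDerivAt {k : ℕ} {f : Phase → ℝ} (hf : IsCx (k + 1) f) (x : V3) (p : Sph × ℝ) :
    HasFDerivAt (fun x => f (x, p))
      (∑ i, Transport.pd i f (x, p) • (EuclideanSpace.proj i : V3 →L[ℝ] ℝ)) x :=
  hasFDerivAt_of_continuous_partials (g' := fun i x => Transport.pd i f (x, p))
    (fun i => (hf.pd i).continuous.comp (by fun_prop))
    (fun i x => hf.hasLineDerivAt i x p) x

/-- The bridge from iterated continuous partial derivatives to Fréchet smoothness in x. It makes the
symmetry of second derivatives available for the germs used later. -/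
theorem IsCx.contDiff {k : ℕ} {f : Phase → ℝ} (hf : IsCx k f) (p : Sph × ℝ) :
    ContDiff ℝ k (fun x => f (x, p)) := by
  induction k generalizing f with
  | zero =>
    have : Continuous fun x => f (x, p) := hf.continuous.comp (by fun_prop)
    exact_mod_cast contDiff_zero.2 this
  | succ k ih =>
    have := contDiff_succ_iff_hasFDerivAt (𝕜 := ℝ) (n := k) (f := fun x => f (x, p))
    push_cast
    refine this.2 ⟨_, ?_, fun x => hf.hasFDerivAt x p⟩
    exact ContDiff.sum fun i _ => (ih (hf.pd i)).smul contDiff_const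

theorem hasLineDerivAt_const (c : ℝ) (x v : V3) : HasLineDerivAt ℝ (fun _ => c) 0 x v :=
  hasDerivAt_const (0 : ℝ) c

theorem IsCx.zero (k : ℕ) : IsCx k (fun _ => 0) := by
  induction k with
  | zero => exact continuous_const
  | succ k ih =>
    refine IsCx.of_hasLineDerivAt (g := fun _ _ => 0) continuous_const (fun i x p => ?_)
      (fun _ => ih)
    exact hasLineDerivAt_const _ _ _

theorem IsCx.add {k : ℕ} {f g : Phase → ℝ} (hf : IsCx k f) (hg : IsCx k g) :
    IsCx k (fun z => f z + g z) := by
  induction k generalizing f g with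
  | zero => exact Continuous.add hf hg
  | succ k ih =>
    refine IsCx.of_hasLineDerivAt (hf.continuous.add hg.continuous)
      (g := fun i z => Transport.pd i f z + Transport.pd i g z) (fun i x p => ?_)
      (fun i => ih (hf.pd i) (hg.pd i))
    have h1 := hf.hasLineDerivAt i x p
    have h2 := hg.hasLineDerivAt i x p
    unfold HasLineDerivAt at *
    exact h1.fun_add h2

theorem IsCx.mul {k : ℕ} {f g : Phase → ℝ} (hf : IsCx k f) (hg : IsCx k g) :
    IsCx k (fun z => f z * g z) := by
  induction k generalizing f g with
  | zero => exact Continuous.mul hf hg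
  | succ k ih =>
    refine IsCx.of_hasLineDerivAt (hf.continuous.mul hg.continuous)
      (g := fun i z => Transport.pd i f z * g z + f z * Transport.pd i g z)
      (fun i x p => ?_)
      (fun i => (ih (hf.pd i) hg.pred).add (ih hf.pred (hg.pd i)))
    have h1 := hf.hasLineDerivAt i x p
    have h2 := hg.hasLineDerivAt i x p
    unfold HasLineDerivAt at *
    simpa using h1.fun_mul h2

theorem IsCx.sum {k : ℕ} {ι : Type*} {s : Finset ι} {f : ι → Phase → ℝ}
    (hf : ∀ i ∈ s, IsCx k (f i)) : IsCx k (fun z => ∑ i ∈ s, f i z) := by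
  classical
  induction s using Finset.induction_on with
  | empty => simpa using IsCx.zero k
  | insert a s ha ih =>
    simp only [Finset.sum_insert ha]
    exact (hf a (by simp)).add (ih fun i hi => hf i (by simp [hi]))

/-- Continuous functions of `(ω, E)` are smooth in the space variable. -/
theorem IsCx.of_snd (k : ℕ) {b : Sph × ℝ → ℝ} (hb : Continuous b) : IsCx k (fun z => b z.2) := by
  cases k with
  | zero => exact hb.comp continuous_snd
  | succ k =>
    refine IsCx.of_hasLineDerivAt (g := fun _ _ => 0) (hb.comp continuous_snd)
      (fun i x p => ?_) (fun _ => IsCx.zero k)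
    exact hasLineDerivAt_const (b p) x _

theorem IsCx.const_mul {k : ℕ} {f : Phase → ℝ} (hf : IsCx k f) (c : ℝ) :
    IsCx k (fun z => c * f z) :=
  (IsCx.of_snd k (b := fun _ => c) continuous_const).mul hf

/-- The coordinates of the direction `ω`. -/
theorem IsCx.direction (k : ℕ) (i : Fin 3) : IsCx k (fun z => (z.2.1 : V3) i) :=
  IsCx.of_snd k (b := fun p => (p.1 : V3) i) (by fun_prop)

theorem IsCx.advect {k : ℕ} {f : Phase → ℝ} (hf : IsCx (k + 1) f) : IsCx k (advect f) :=
  IsCx.sum fun i _ => (IsCx.direction k i).mul (hf.pd i)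

/-! ### Smooth cutoff functions on the phase space -/

/-- The linear space containing the phase space. -/
abbrev Ambient : Type := V3 × V3 × ℝ

/-- The inclusion of the phase space into the ambient linear space. -/
def toAmbient (z : Phase) : Ambient := (z.1, (z.2.1 : V3), z.2.2)

/-- Lets smooth separation and the fundamental lemma of the calculus of variations be taken from a
linear space, without charts on the sphere. -/
theorem isClosedEmbedding_toAmbient : Topology.IsClosedEmbedding toAmbient := by
  have h : Topology.IsClosedEmbedding (Subtype.val : Sph → V3) :=
    Metric.isClosed_sphere.isClosedEmbedding_subtypeVal
  exact Topology.IsClosedEmbedding.id.prodMap (h.prodMap .id)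

theorem IsCx.of_contDiff (k : ℕ) {X : Ambient → ℝ} (hX : ContDiff ℝ ∞ X) :
    IsCx k (fun z => X (toAmbient z)) := by
  induction k generalizing X with
  | zero => exact hX.continuous.comp isClosedEmbedding_toAmbient.continuous
  | succ k ih =>
    refine IsCx.of_hasLineDerivAt (hX.continuous.comp isClosedEmbedding_toAmbient.continuous)
      (g := fun i z => fderiv ℝ X (toAmbient z) (basisVec i, 0, 0)) (fun i x p => ?_)
      (fun i => ih (X := fun y => fderiv ℝ X y (basisVec i, 0, 0)) ?_)
    · have h := ((hX.differentiable (by simp) (toAmbient (x, p))).hasFDerivAt).hasLineDerivAt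
        (basisVec i, 0, 0)
      unfold HasLineDerivAt at *
      simpa [toAmbient] using h
    · exact (hX.fderiv_right (m := ∞) (by simp)).clm_apply contDiff_const

/-- Smooth separation of disjoint closed sets of the phase space. -/
theorem exists_cutoff {K B : Set Phase} (hK : IsClosed K) (hB : IsClosed B) (hd : Disjoint K B) :
    ∃ χ : Phase → ℝ, (∀ k, IsCx k χ) ∧ (∀ z ∈ K, χ z = 1) ∧ ∀ z ∈ B, χ z = 0 := by
  have hK' := isClosedEmbedding_toAmbient.isClosedMap _ hK
  have hB' := isClosedEmbedding_toAmbient.isClosedMap _ hB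
  have hd' : Disjoint (toAmbient '' B) (toAmbient '' K) :=
    (disjoint_image_iff isClosedEmbedding_toAmbient.injective).2 hd.symm
  obtain ⟨f, h0, h1, -⟩ := exists_contMDiffMap_zero_one_of_isClosed
    (modelWithCornersSelf ℝ Ambient) (n := ⊤) hB' hK' hd'
  refine ⟨fun z => f (toAmbient z), fun k => IsCx.of_contDiff k f.contMDiff.contDiff, ?_, ?_⟩
  · exact fun z hz => h1 (mem_image_of_mem _ hz)
  · exact fun z hz => h0 (mem_image_of_mem _ hz)

/-- A compactly supported smooth function that is one on a given bounded set. -/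
theorem exists_compact_cutoff {K : Set Phase} (hK : IsCompact K) :
    ∃ χ : Phase → ℝ, (∀ k, IsCxCompact k χ) ∧ ∀ z ∈ K, χ z = 1 := by
  obtain ⟨R, hR⟩ := (hK.image isClosedEmbedding_toAmbient.continuous).isBounded.subset_closedBall 0
  -- The maximum with 1 keeps the inner radius positive, since nothing is known about the sign of R.
  let b : ContDiffBump (0 : Ambient) := ⟨max R 1, max R 1 + 1, by positivity, by linarith⟩
  refine ⟨fun z => b (toAmbient z), fun k => ⟨IsCx.of_contDiff k b.contDiff, ?_⟩, fun z hz => ?_⟩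
  · exact b.hasCompactSupport.comp_isClosedEmbedding isClosedEmbedding_toAmbient
  · refine b.one_of_mem_closedBall ?_
    have := hR (mem_image_of_mem _ hz)
    exact Metric.closedBall_subset_closedBall (le_max_left _ _) this

/-! #### Locality and supports -/

theorem isOpen_phaseInterior {G : Set V3} (hG : IsOpen G) (E₀ Eₘ : ℝ) :
    IsOpen (phaseInterior G E₀ Eₘ) :=
  (hG.preimage continuous_fst).inter (isOpen_Ioo.preimage (by fun_prop :
    Continuous fun z : Phase => z.2.2))

theorem pd_congr {U : Set Phase} (hU : IsOpen U) {f g : Phase → ℝ} (h : EqOn f g U) (i : Fin 3) :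
    EqOn (pd i f) (pd i g) U := by
  rintro ⟨x, p⟩ hz
  have hc : Continuous fun x' : V3 => ((x', p) : Phase) := by fun_prop
  refine Filter.EventuallyEq.lineDeriv_eq ?_
  filter_upwards [(hU.preimage hc).mem_nhds hz] with x' hx'
  exact h hx'

theorem advect_congr {U : Set Phase} (hU : IsOpen U) {f g : Phase → ℝ} (h : EqOn f g U) :
    EqOn (advect f) (advect g) U := fun z hz => by
  simp only [advect, pd_congr hU h _ hz]

theorem pd_eq_zero {f : Phase → ℝ} (i : Fin 3) : ∀ z ∉ tsupport f, pd i f z = 0 := by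
  intro z hz
  have h : EqOn f (fun _ => 0) (tsupport f)ᶜ := fun z hz => image_eq_zero_of_notMem_tsupport hz
  rw [pd_congr (isClosed_tsupport f).isOpen_compl h i hz]
  exact (hasLineDerivAt_const 0 _ _).lineDeriv

theorem advect_eq_zero {f : Phase → ℝ} : ∀ z ∉ tsupport f, advect f z = 0 := by
  intro z hz
  simp [advect, pd_eq_zero _ z hz]

theorem IsCxCompact.pd {k : ℕ} {f : Phase → ℝ} (hf : IsCxCompact (k + 1) f) (i : Fin 3) :
    IsCxCompact k (pd i f) :=
  ⟨hf.1.pd i, HasCompactSupport.intro hf.2 (pd_eq_zero i)⟩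

theorem IsCxCompact.advect {k : ℕ} {f : Phase → ℝ} (hf : IsCxCompact (k + 1) f) :
    IsCxCompact k (advect f) :=
  ⟨hf.1.advect, HasCompactSupport.intro hf.2 advect_eq_zero⟩

theorem IsCxCompact.mono {k l : ℕ} {f : Phase → ℝ} (hf : IsCxCompact k f) (h : l ≤ k) :
    IsCxCompact l f :=
  ⟨hf.1.mono h, hf.2⟩

theorem IsCxCompact.add {k : ℕ} {f g : Phase → ℝ} (hf : IsCxCompact k f) (hg : IsCxCompact k g) :
    IsCxCompact k (fun z => f z + g z) :=
  ⟨hf.1.add hg.1, hf.2.add hg.2⟩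

theorem IsCxCompact.mul_left {k : ℕ} {f g : Phase → ℝ} (hf : IsCx k f) (hg : IsCxCompact k g) :
    IsCxCompact k (fun z => f z * g z) :=
  ⟨hf.mul hg.1, hg.2.mul_left⟩

theorem pd_mul {f g : Phase → ℝ} (hf : IsCx 1 f) (hg : IsCx 1 g) (i : Fin 3) (z : Phase) :
    pd i (fun z => f z * g z) z = pd i f z * g z + f z * pd i g z := by
  have h1 := hf.hasLineDerivAt i z.1 z.2
  have h2 := hg.hasLineDerivAt i z.1 z.2
  have : HasLineDerivAt ℝ (fun x => f (x, z.2) * g (x, z.2)) (pd i f z * g z + f z * pd i g z) z.1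
      (basisVec i) := by
    unfold HasLineDerivAt at *
    simpa using h1.fun_mul h2
  exact this.lineDeriv

theorem advect_mul {f g : Phase → ℝ} (hf : IsCx 1 f) (hg : IsCx 1 g) (z : Phase) :
    advect (fun z => f z * g z) z = advect f z * g z + f z * advect g z := by
  simp only [advect, pd_mul hf hg, Fin.sum_univ_three]
  ring

/-! ### Integration along translations -/

/-- The measure `dx dω dE` on `ℝ³ × S × I`. -/
def fullMeasure (E₀ Eₘ : ℝ) : Measure Phase :=
  (volume : Measure V3).prod
    ((volume : Measure V3).toSphere.prod ((volume : Measure ℝ).restrict (Icc E₀ Eₘ)))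

instance (E₀ Eₘ : ℝ) : IsFiniteMeasureOnCompacts (fullMeasure E₀ Eₘ) := by
  unfold fullMeasure; infer_instance

theorem phaseMeasure_eq_restrict (G : Set V3) (E₀ Eₘ : ℝ) :
    phaseMeasure G E₀ Eₘ = (fullMeasure E₀ Eₘ).restrict (G ×ˢ univ) := by
  rw [phaseMeasure, fullMeasure, ← Measure.prod_restrict, Measure.restrict_univ]

instance (G : Set V3) (E₀ Eₘ : ℝ) : IsFiniteMeasureOnCompacts (phaseMeasure G E₀ Eₘ) := by
  unfold phaseMeasure; infer_instance

/-- The faces E = E₀ and E = Eₘ are null sets. Thus an identity on the open set G × S × I°, where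
elements of 𝒟 are controlled, holds almost everywhere. -/
theorem ae_mem_phaseInterior {G : Set V3} (hG : IsOpen G) (E₀ Eₘ : ℝ) :
    ∀ᵐ z ∂(phaseMeasure G E₀ Eₘ), z ∈ phaseInterior G E₀ Eₘ := by
  have h1 : ∀ᵐ z ∂(phaseMeasure G E₀ Eₘ), z.1 ∈ G :=
    Measure.quasiMeasurePreserving_fst.ae (ae_restrict_mem hG.measurableSet)
  have h2 : ∀ᵐ z ∂(phaseMeasure G E₀ Eₘ), z.2.2 ∈ Ioo E₀ Eₘ := by
    refine (Measure.quasiMeasurePreserving_snd.comp Measure.quasiMeasurePreserving_snd).ae ?_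
    rw [← restrict_Ioo_eq_restrict_Icc]
    exact ae_restrict_mem measurableSet_Ioo
  filter_upwards [h1, h2] with z hz1 hz2 using ⟨hz1, hz2⟩

/-- Translation by `-h v(ω, E)` in the space variable. -/
def shift (v : Sph × ℝ → V3) (h : ℝ) (z : Phase) : Phase := (z.1 - h • v z.2, z.2)

theorem continuous_shift {v : Sph × ℝ → V3} (hv : Continuous v) :
    Continuous fun q : ℝ × Phase => shift v q.1 q.2 := by
  unfold shift; fun_prop

theorem shift_shift (v : Sph × ℝ → V3) (h h' : ℝ) (z : Phase) :
    shift v h (shift v h' z) = shift v (h + h') z := by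
  simp only [shift, Prod.mk.injEq, and_true]; module

theorem shift_zero (v : Sph × ℝ → V3) (z : Phase) : shift v 0 z = z := by simp [shift]

/-- With the factors swapped this is a skew product: for each fixed (ω, E) the map is a translation
of three-space. -/
theorem measurePreserving_shift {v : Sph × ℝ → V3} (hv : Continuous v) (h : ℝ) (E₀ Eₘ : ℝ) :
    MeasurePreserving (shift v h) (fullMeasure E₀ Eₘ) (fullMeasure E₀ Eₘ) := by
  set μ := (volume : Measure V3).toSphere.prod ((volume : Measure ℝ).restrict (Icc E₀ Eₘ))
  have h1 : MeasurePreserving (fun q : (Sph × ℝ) × V3 => (q.1, q.2 - h • v q.1))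
      (μ.prod volume) (μ.prod volume) :=
    (MeasurePreserving.id μ).skew_product (g := fun p x => x - h • v p)
      (by have : Continuous (Function.uncurry fun (p : Sph × ℝ) (x : V3) => x - h • v p) := by
            fun_prop
          exact this.measurable)
      (.of_forall fun p => (measurePreserving_sub_right volume (h • v p)).map_eq)
  have h2 : MeasurePreserving Prod.swap ((volume : Measure V3).prod μ) (μ.prod volume) :=
    Measure.measurePreserving_swap
  have h3 : MeasurePreserving Prod.swap (μ.prod (volume : Measure V3)) (Measure.prod volume μ) :=
    Measure.measurePreserving_swap
  exact h3.comp (h1.comp h2)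

theorem integral_comp_shift {v : Sph × ℝ → V3} (hv : Continuous v) (h : ℝ) (E₀ Eₘ : ℝ)
    (f : Phase → ℝ) : ∫ z, f (shift v h z) ∂(fullMeasure E₀ Eₘ) = ∫ z, f z ∂(fullMeasure E₀ Eₘ) := by
  have hc : ∀ h, Continuous (shift v h) := fun h =>
    (continuous_shift hv).comp (by fun_prop : Continuous fun z : Phase => (h, z))
  let e : Phase ≃ₜ Phase :=
    { toFun := shift v h
      invFun := shift v (-h)
      left_inv := fun z => by rw [shift_shift, neg_add_cancel, shift_zero]
      right_inv := fun z => by rw [shift_shift, add_neg_cancel, shift_zero]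
      continuous_toFun := hc h
      continuous_invFun := hc (-h) }
  exact (measurePreserving_shift hv h E₀ Eₘ).integral_comp e.measurableEmbedding f

/-- The derivative in the direction `v(ω, E)` in the space variable. -/
def dirDeriv (v : Sph × ℝ → V3) (f : Phase → ℝ) : Phase → ℝ := fun z => ∑ i, v z.2 i * pd i f z

theorem dirDeriv_direction (f : Phase → ℝ) : dirDeriv (fun p => (p.1 : V3)) f = advect f := rfl

theorem dirDeriv_basisVec (i : Fin 3) (f : Phase → ℝ) :
    dirDeriv (fun _ => basisVec i) f = pd i f := by
  funext z
  simp only [dirDeriv]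
  rw [Finset.sum_eq_single i]
  · simp
  · intro j _ hj; simp [hj]
  · simp

theorem IsCx.hasDerivAt_shift {f : Phase → ℝ} (hf : IsCx 1 f) (v : Sph × ℝ → V3) (z : Phase)
    (h : ℝ) : HasDerivAt (fun h => f (shift v h z)) (-dirDeriv v f (shift v h z)) h := by
  have h1 := hf.hasFDerivAt (z.1 - h • v z.2) z.2
  have h2 : HasDerivAt (fun h : ℝ => z.1 - h • v z.2) (-((1 : ℝ) • v z.2)) h :=
    ((hasDerivAt_id h).smul_const (v z.2)).const_sub z.1
  have h3 := h1.comp_hasDerivAt h h2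
  have h4 : (∑ i, Transport.pd i f (z.1 - h • v z.2, z.2) • (EuclideanSpace.proj i : V3 →L[ℝ] ℝ))
      (-((1 : ℝ) • v z.2)) = -dirDeriv v f (shift v h z) := by
    simp [dirDeriv, shift, Fin.sum_univ_three]
    ring
  rw [h4] at h3
  exact h3

theorem IsCx.continuous_dirDeriv {f : Phase → ℝ} (hf : IsCx 1 f) {v : Sph × ℝ → V3}
    (hv : Continuous v) : Continuous (dirDeriv v f) := by
  refine continuous_finsetSum _ fun i _ => ?_
  have := (hf.pd i).continuous
  fun_prop

theorem dirDeriv_eq_zero {f : Phase → ℝ} (v : Sph × ℝ → V3) :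
    ∀ z ∉ tsupport f, dirDeriv v f z = 0 := by
  intro z hz
  simp [dirDeriv, pd_eq_zero _ z hz]

/-- Differentiation of an integral under a translation of the integrand. -/
theorem hasDerivAt_integral_shift (ν : Measure Phase) [IsFiniteMeasureOnCompacts ν]
    {v : Sph × ℝ → V3} (hv : Continuous v) {f : Phase → ℝ} (hf : IsCxCompact 1 f) :
    HasDerivAt (fun h => ∫ z, f (shift v h z) ∂ν) (-∫ z, dirDeriv v f z ∂ν) 0 := by
  have hD := hf.1.continuous_dirDeriv hv
  have hDc : HasCompactSupport (dirDeriv v f) := HasCompactSupport.intro hf.2 (dirDeriv_eq_zero v)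
  obtain ⟨M, hM⟩ := hDc.exists_bound_of_continuous hD
  -- For |h| < 1 all the translated supports lie in this one compact set, so M times its indicator
  -- dominates the derivatives in h.
  have hK : IsCompact ((fun q : ℝ × Phase => shift v q.1 q.2) '' (Icc (-1) 1 ×ˢ tsupport f)) :=
    (isCompact_Icc.prod hf.2).image (continuous_shift hv)
  set K := (fun q : ℝ × Phase => shift v q.1 q.2) '' (Icc (-1) 1 ×ˢ tsupport f)
  have hs : ∀ h, Continuous (shift v h) := fun h =>
    (continuous_shift hv).comp (by fun_prop : Continuous fun z : Phase => (h, z))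
  have key := hasDerivAt_integral_of_dominated_loc_of_deriv_le (μ := ν)
    (F := fun h z => f (shift v h z)) (F' := fun h z => -dirDeriv v f (shift v h z))
    (x₀ := (0 : ℝ)) (s := Metric.ball 0 1) (bound := K.indicator fun _ => M)
    (Metric.ball_mem_nhds _ one_pos)
    (.of_forall fun h => (hf.1.continuous.comp (hs h)).aestronglyMeasurable)
    (by simpa only [shift_zero] using hf.1.continuous.integrable_of_hasCompactSupport hf.2)
    (by simpa only [shift_zero] using hD.fun_neg.aestronglyMeasurable)
    (.of_forall fun z h hh => ?_)
    ((integrable_indicator_iff hK.measurableSet).2 (integrableOn_const hK.measure_lt_top.ne))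
    (.of_forall fun z h _ => hf.1.hasDerivAt_shift v z h)
  · simpa only [shift_zero, integral_neg] using key.2
  · rw [norm_neg]
    by_cases hz : shift v h z ∈ tsupport f
    · have : z ∈ K := by
        refine ⟨(-h, shift v h z), ⟨?_, hz⟩, ?_⟩
        · rw [Metric.mem_ball, dist_zero_right, Real.norm_eq_abs, abs_lt] at hh
          constructor <;> simp only <;> linarith
        · simp [shift_shift, shift_zero]
      rw [indicator_of_mem this]
      exact hM _
    · rw [dirDeriv_eq_zero v _ hz, norm_zero]
      exact indicator_nonneg (fun _ _ => (norm_nonneg _).trans (hM z)) _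

/-- The integral of a directional derivative over the whole space vanishes. -/
theorem integral_dirDeriv_eq_zero (E₀ Eₘ : ℝ) {v : Sph × ℝ → V3} (hv : Continuous v)
    {f : Phase → ℝ} (hf : IsCxCompact 1 f) : ∫ z, dirDeriv v f z ∂(fullMeasure E₀ Eₘ) = 0 := by
  have h1 := hasDerivAt_integral_shift (fullMeasure E₀ Eₘ) hv hf
  simp only [integral_comp_shift hv] at h1
  have := h1.unique (hasDerivAt_const _ _)
  linarith

theorem integral_phaseMeasure_eq {G : Set V3} (E₀ Eₘ : ℝ) {f : Phase → ℝ}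
    (hf : ∀ z : Phase, z.1 ∉ G → f z = 0) :
    ∫ z, f z ∂(phaseMeasure G E₀ Eₘ) = ∫ z, f z ∂(fullMeasure E₀ Eₘ) := by
  rw [phaseMeasure_eq_restrict]
  exact setIntegral_eq_integral_of_forall_compl_eq_zero fun z hz => hf z fun h => hz ⟨h, mem_univ _⟩

theorem integral_dirDeriv_phase_eq_zero {G : Set V3} (E₀ Eₘ : ℝ) {v : Sph × ℝ → V3}
    (hv : Continuous v) {f : Phase → ℝ} (hf : IsCxCompact 1 f)
    (hG : ∀ z ∈ tsupport f, z.1 ∈ G) :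
    ∫ z, dirDeriv v f z ∂(phaseMeasure G E₀ Eₘ) = 0 := by
  rw [integral_phaseMeasure_eq, integral_dirDeriv_eq_zero E₀ Eₘ hv hf]
  exact fun z hz => dirDeriv_eq_zero v z fun h => hz (hG z h)

/-- The set of points that are reached from `G` by going back along a characteristic and that
lie outside of `G`. -/
def backwardShadow (G : Set V3) : Set Phase :=
  {z | z.1 ∉ G ∧ ∃ t : ℝ, 0 ≤ t ∧ z.1 + t • (z.2.1 : V3) ∈ G}

/-- The streaming operator is accretive on functions that vanish on the backward shadow. -/
theorem integral_mul_advect_nonneg {G : Set V3} (hG : IsOpen G) (E₀ Eₘ : ℝ) {f : Phase → ℝ}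
    (hf : IsCxCompact 1 f) (h0 : ∀ z ∈ backwardShadow G, f z = 0) :
    0 ≤ ∫ z, f z * advect f z ∂(phaseMeasure G E₀ Eₘ) := by
  set v : Sph × ℝ → V3 := fun p => (p.1 : V3)
  have hv : Continuous v := by fun_prop
  have hf2 : IsCxCompact 1 (fun z => f z * f z) := IsCxCompact.mul_left hf.1 hf
  have hder := hasDerivAt_integral_shift (phaseMeasure G E₀ Eₘ) hv hf2
  have heq : ∀ z, dirDeriv v (fun z => f z * f z) z = 2 * (f z * advect f z) := by
    intro z
    rw [dirDeriv_direction, advect_mul hf.1 hf.1]; ring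
  simp only [heq, integral_const_mul] at hder
  have hm : MeasurableSet (G ×ˢ (univ : Set (Sph × ℝ))) := hG.measurableSet.prod .univ
  -- Pointwise, 1_G(x) f(x - hω)² ≤ (1_G f²)(x - hω): if x ∈ G but x - hω ∉ G, then x - hω is in the
  -- backward shadow and f vanishes there. The integral of the right side does not depend on h.
  have hle : ∀ h : ℝ, 0 ≤ h → ∫ z, f (shift v h z) * f (shift v h z) ∂(phaseMeasure G E₀ Eₘ) ≤
      ∫ z, f z * f z ∂(phaseMeasure G E₀ Eₘ) := by
    intro h hh
    rw [phaseMeasure_eq_restrict, ← integral_indicator hm, ← integral_indicator hm,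
      ← integral_comp_shift hv h _ _ ((G ×ˢ univ).indicator fun z => f z * f z)]
    have hi : Integrable ((G ×ˢ (univ : Set (Sph × ℝ))).indicator fun z => f z * f z)
        (fullMeasure E₀ Eₘ) :=
      (hf2.1.continuous.integrable_of_hasCompactSupport hf2.2).indicator hm
    refine integral_mono_of_nonneg
      (.of_forall fun z => indicator_nonneg (fun z _ => mul_self_nonneg _) z)
      ((measurePreserving_shift hv h E₀ Eₘ).integrable_comp_of_integrable hi)
      (.of_forall fun z => ?_)
    simp only
    by_cases hz : z ∈ G ×ˢ (univ : Set (Sph × ℝ))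
    · rw [indicator_of_mem hz]
      by_cases hz' : shift v h z ∈ G ×ˢ (univ : Set (Sph × ℝ))
      · rw [indicator_of_mem hz']
      · have : shift v h z ∈ backwardShadow G :=
          ⟨fun h' => hz' ⟨h', mem_univ _⟩, h, hh, by simpa [shift, v] using hz.1⟩
        rw [h0 _ this]
        simpa using indicator_nonneg (fun z _ => mul_self_nonneg (f z)) _
    · rw [indicator_of_notMem hz]
      exact indicator_nonneg (fun z _ => mul_self_nonneg _) _
  -- The right derivative at h = 0 is -2 ∫ f ω·∇ₓf, and the inequality above makes every difference
  -- quotient nonpositive.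
  have := (hasDerivWithinAt_iff_tendsto_slope' (s := Ioi (0 : ℝ)) (by simp)).1
    hder.hasDerivWithinAt
  have h2 := le_of_tendsto this (b := 0) (by
    filter_upwards [self_mem_nhdsWithin] with h hh
    have hh : 0 < h := hh
    rw [slope_def_field]
    refine div_nonpos_of_nonpos_of_nonneg ?_ (by linarith)
    have := hle h hh.le
    simp only [shift_zero]
    linarith)
  linarith

/-! ### Geometry of the domain -/

theorem IsLocalDefiningFunction.hasFDerivAt {G : Set V3} {y : V3} {ρ : V3 → ℝ}
    (hρ : IsLocalDefiningFunction G y ρ) (x : V3) :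
    HasFDerivAt ρ (innerSL ℝ (gradient ρ x)) x :=
  ((hρ.1.differentiable (by simp)) x).hasGradientAt.hasFDerivAt

theorem IsLocalDefiningFunction.continuous_gradient {G : Set V3} {y : V3} {ρ : V3 → ℝ}
    (hρ : IsLocalDefiningFunction G y ρ) : Continuous (gradient ρ) := by
  unfold gradient
  exact (InnerProductSpace.toDual ℝ V3).symm.continuous.comp (hρ.1.continuous_fderiv (by simp))

theorem IsLocalDefiningFunction.eventually_nonpos {G : Set V3} {y : V3} {ρ : V3 → ℝ}
    (hρ : IsLocalDefiningFunction G y ρ) : ∀ᶠ x in 𝓝 y, x ∈ closure G → ρ x ≤ 0 := by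
  filter_upwards [hρ.2.2.eventually_nhds] with x hx hxG
  have h1 : ∃ᶠ x' in 𝓝 x, ρ x' ≤ 0 :=
    ((mem_closure_iff_frequently.1 hxG).and_eventually hx).mono fun x' h => (h.2.1 h.1).le
  exact le_of_tendsto_of_frequently hρ.1.continuous.continuousAt h1

theorem IsLocalDefiningFunction.apply_eq_zero {G : Set V3} (hG : IsOpen G) {y : V3} {ρ : V3 → ℝ}
    (hρ : IsLocalDefiningFunction G y ρ) (hy : y ∈ frontier G) : ρ y = 0 := by
  rw [hG.frontier_eq] at hy
  refine le_antisymm (hρ.eventually_nonpos.self_of_nhds hy.1) (not_lt.1 fun h => hy.2 ?_)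
  exact hρ.2.2.self_of_nhds.2 h

/-- The closure of a smooth convex domain lies on one side of the tangent plane. -/
theorem IsSmoothStrictlyConvexDomain.inner_gradient_nonpos {G : Set V3}
    (hG : IsSmoothStrictlyConvexDomain G) {y : V3} (hy : y ∈ frontier G) {ρ : V3 → ℝ}
    (hρ : IsLocalDefiningFunction G y ρ) {z : V3} (hz : z ∈ closure G) :
    inner ℝ (gradient ρ y) (z - y) ≤ 0 := by
  have h1 : HasDerivAt (fun s : ℝ => ρ (y + s • (z - y))) (inner ℝ (gradient ρ y) (z - y)) 0 := by
    have := (hρ.hasFDerivAt y).hasLineDerivAt (z - y)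
    simpa [HasLineDerivAt] using this
  have h2 := (hasDerivWithinAt_iff_tendsto_slope' (s := Ioi (0 : ℝ)) (by simp)).1
    h1.hasDerivWithinAt
  have hc : Tendsto (fun s : ℝ => y + s • (z - y)) (𝓝[>] 0) (𝓝 y) := by
    have : Continuous fun s : ℝ => y + s • (z - y) := by fun_prop
    simpa using (this.tendsto 0).mono_left nhdsWithin_le_nhds
  -- The segment from y to z stays in the convex closure, where ρ ≤ 0 near y, while ρ y = 0. The
  -- one-sided difference quotients are therefore nonpositive.
  refine le_of_tendsto h2 ?_
  filter_upwards [self_mem_nhdsWithin, hc.eventually hρ.eventually_nonpos,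
    (Iio_mem_nhds one_pos : Iio (1 : ℝ) ∈ 𝓝 0) |> mem_nhdsWithin_of_mem_nhds] with s hs hρs hs1
  have hs : 0 < s := hs
  have hs1 : s < 1 := hs1
  have hmem : y + s • (z - y) ∈ closure G :=
    hG.strictConvex.convex.add_smul_sub_mem (frontier_subset_closure hy) hz ⟨hs.le, hs1.le⟩
  rw [slope_def_field]
  refine div_nonpos_of_nonpos_of_nonneg ?_ (by linarith)
  simpa [hρ.apply_eq_zero hG.isOpen hy] using hρs hmem

/-- An interior point can be moved slightly in the direction of the gradient without leaving the
closure. The moved point still satisfies the weak inequality, so the original one satisfies it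
strictly. -/
theorem IsSmoothStrictlyConvexDomain.inner_gradient_neg {G : Set V3}
    (hG : IsSmoothStrictlyConvexDomain G) {y : V3} (hy : y ∈ frontier G) {ρ : V3 → ℝ}
    (hρ : IsLocalDefiningFunction G y ρ) {z : V3} (hz : z ∈ interior (closure G)) :
    inner ℝ (gradient ρ y) (z - y) < 0 := by
  have hc : ContinuousAt (fun s : ℝ => z + s • gradient ρ y) 0 := by fun_prop
  have h1 : ∀ᶠ s : ℝ in 𝓝 0, z + s • gradient ρ y ∈ closure G :=
    hc.eventually (by simpa using mem_interior_iff_mem_nhds.1 hz)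
  have h2 : ∀ᶠ s : ℝ in 𝓝[>] 0, z + s • gradient ρ y ∈ closure G :=
    h1.filter_mono nhdsWithin_le_nhds
  obtain ⟨s, hs, hs0⟩ := (h2.and self_mem_nhdsWithin).exists
  have hs0 : 0 < s := hs0
  have h2 := hG.inner_gradient_nonpos hy hρ hs
  have h3 : z + s • gradient ρ y - y = (z - y) + s • gradient ρ y := by abel
  rw [h3, inner_add_right, inner_smul_right, real_inner_self_eq_norm_sq] at h2
  have h4 : 0 < ‖gradient ρ y‖ := norm_pos_iff.2 hρ.2.1
  have : 0 < s * ‖gradient ρ y‖ ^ 2 := by positivity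
  linarith

/-- Near an outgoing boundary point, characteristics that start outside of `G` do not enter
`G`. -/
theorem IsSmoothStrictlyConvexDomain.notMem_closure_backwardShadow {G : Set V3}
    (hG : IsSmoothStrictlyConvexDomain G) {z : Phase} (hz : z.1 ∈ frontier G) {ρ : V3 → ℝ}
    (hρ : IsLocalDefiningFunction G z.1 ρ) (hpos : 0 < inner ℝ (gradient ρ z.1) (z.2.1 : V3)) :
    z ∉ closure (backwardShadow G) := by
  obtain ⟨y, θ, E⟩ := z
  simp only at hz hρ hpos
  set δ := inner ℝ (gradient ρ y) (θ : V3) / 2 with hδ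
  have hδ0 : 0 < δ := by positivity
  have hΦ : Continuous fun q : V3 × V3 => (inner ℝ (gradient ρ q.1) q.2 : ℝ) :=
    (hρ.continuous_gradient.comp continuous_fst).inner continuous_snd
  have h1 : ∀ᶠ q : V3 × V3 in 𝓝 (y, (θ : V3)), δ < inner ℝ (gradient ρ q.1) q.2 :=
    (hΦ.tendsto (y, (θ : V3))).eventually (lt_mem_nhds (by simp only; linarith))
  have h2 : ∀ᶠ q : V3 × V3 in 𝓝 (y, (θ : V3)), (q.1 ∈ G ↔ ρ q.1 < 0) :=
    ((continuous_fst (X := V3) (Y := V3)).tendsto (y, (θ : V3))).eventually hρ.2.2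
  obtain ⟨r, hr, hball⟩ := Metric.eventually_nhds_iff_ball.1 (h1.and h2)
  have hmem : ∀ x w : V3, dist x y < r → dist w θ < r → (x, w) ∈ Metric.ball (y, (θ : V3)) r := by
    intro x w hx hw
    rw [Metric.mem_ball, Prod.dist_eq]
    exact max_lt hx hw
  rw [mem_closure_iff_frequently]
  intro hfreq
  refine hfreq ?_
  have e1 : ∀ᶠ z' : Phase in 𝓝 (y, θ, E), dist z'.1 y < r / 2 :=
    (by fun_prop : Continuous fun z' : Phase => dist z'.1 y).tendsto (y, θ, E) |>.eventually
      (gt_mem_nhds (by simpa using hr))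
  have e2 : ∀ᶠ z' : Phase in 𝓝 (y, θ, E), dist (z'.2.1 : V3) θ < r :=
    (by fun_prop : Continuous fun z' : Phase => dist (z'.2.1 : V3) θ).tendsto (y, θ, E)
      |>.eventually (gt_mem_nhds (by simpa using hr))
  have e3 : ∀ᶠ z' : Phase in 𝓝 (y, θ, E), -(r / 2 * δ) < inner ℝ (gradient ρ y) (z'.1 - y) :=
    (by fun_prop : Continuous fun z' : Phase => (inner ℝ (gradient ρ y) (z'.1 - y) : ℝ)).tendsto
      (y, θ, E) |>.eventually (lt_mem_nhds (by simp only [sub_self, inner_zero_right]; nlinarith))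
  filter_upwards [e1, e2, e3] with z' hz1 hz2 hz3
  rintro ⟨hout, t, ht, hin⟩
  set w : V3 := (z'.2.1 : V3)
  have hw : ‖w‖ = 1 := mem_sphere_zero_iff_norm.1 z'.2.1.2
  have hyself : dist y y < r := by simpa using hr
  -- For short times ρ is monotone along the characteristic, so a point of G at time t forces the
  -- starting point into G. For long times the gain tδ beats the initial offset, which exceeds
  -- -(r/2)δ, and the point has crossed the tangent plane.
  rcases lt_or_ge t (r / 2) with htr | htr
  · have hseg : ∀ s ∈ Icc 0 t, dist (z'.1 + s • w) y < r := by
      intro s hs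
      have : dist (z'.1 + s • w) z'.1 = s := by
        rw [dist_eq_norm, add_sub_cancel_left, norm_smul, hw, mul_one, Real.norm_eq_abs,
          abs_of_nonneg hs.1]
      have := dist_triangle (z'.1 + s • w) z'.1 y
      linarith [hs.2]
    have hdiff : ∀ s : ℝ, HasDerivAt (fun s : ℝ => ρ (z'.1 + s • w))
        (inner ℝ (gradient ρ (z'.1 + s • w)) w) s := by
      intro s
      have h := hρ.hasFDerivAt (z'.1 + s • w)
      have h' : HasDerivAt (fun s : ℝ => z'.1 + s • w) ((1 : ℝ) • w) s :=
        ((hasDerivAt_id s).smul_const w).const_add _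
      rw [one_smul] at h'
      exact h.comp_hasDerivAt s h'
    have hmono : MonotoneOn (fun s : ℝ => ρ (z'.1 + s • w)) (Icc 0 t) := by
      refine monotoneOn_of_hasDerivWithinAt_nonneg (convex_Icc 0 t)
        (fun s _ => (hdiff s).continuousAt.continuousWithinAt)
        (fun s _ => (hdiff s).hasDerivWithinAt) fun s hs => ?_
      have := (hball _ (hmem _ w (hseg s (interior_subset hs)) hz2)).1
      simp only at this
      linarith
    have h3 := hmono (left_mem_Icc.2 ht) (right_mem_Icc.2 ht) ht
    have h4 := ((hball _ (hmem _ w (hseg t (right_mem_Icc.2 ht)) hz2)).2).1 hin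
    have h5 := (hball _ (hmem _ w (hseg 0 (left_mem_Icc.2 ht)) hz2)).2
    simp only [zero_smul, add_zero] at h3 h5
    exact hout (h5.2 (lt_of_le_of_lt h3 h4))
  · have h3 := hG.inner_gradient_nonpos hz hρ (subset_closure hin)
    have h4 := (hball _ (hmem y w hyself hz2)).1
    have h5 : z'.1 + t • w - y = (z'.1 - y) + t • w := by abel
    simp only at h4
    rw [h5, inner_add_right, inner_smul_right] at h3
    nlinarith

theorem IsSmoothStrictlyConvexDomain.exists_outwardNormal {G : Set V3}
    (hG : IsSmoothStrictlyConvexDomain G) {y : V3} (hy : y ∈ frontier G) :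
    ∃ n, IsOutwardNormal G y n := by
  obtain ⟨ρ, hρ⟩ := hG.smooth_boundary y hy
  exact ⟨_, ρ, hρ, rfl⟩

/-- A backward characteristic that meets the boundary in an incoming or tangential direction does
not meet the closed domain again. -/
theorem IsSmoothStrictlyConvexDomain.eq_zero_of_sub_smul_mem {G : Set V3}
    (hG : IsSmoothStrictlyConvexDomain G) {y n θ : V3} (hy : y ∈ frontier G)
    (hn : IsOutwardNormal G y n) (hθ : θ ≠ 0) (hle : inner ℝ θ n ≤ 0) {t : ℝ} (ht : 0 ≤ t)
    (hmem : y - t • θ ∈ closure G) : t = 0 := by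
  obtain ⟨ρ, hρ, rfl⟩ := hn
  by_contra h0
  have ht' : 0 < t := lt_of_le_of_ne ht (Ne.symm h0)
  have hne : y - t • θ ≠ y := by
    intro h
    have : t • θ = 0 := by simpa using h
    exact (smul_ne_zero h0 hθ) this
  -- If t > 0, the midpoint of the chord is interior and lies strictly inside the tangent
  -- half-space. This forces θ·∇ρ(y) > 0, contrary to the incoming or tangential direction.
  have hmid := hG.strictConvex hmem (frontier_subset_closure hy) hne
    (a := 1 / 2) (b := 1 / 2) (by norm_num) (by norm_num) (by norm_num)
  have h1 := hG.inner_gradient_neg hy hρ hmid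
  have h2 : (1 / 2 : ℝ) • (y - t • θ) + (1 / 2 : ℝ) • y - y = (-(t / 2)) • θ := by module
  rw [h2, inner_smul_right, real_inner_comm] at h1
  rw [inner_smul_right] at hle
  have h3 : 0 < ‖gradient ρ y‖⁻¹ := inv_pos.2 (norm_pos_iff.2 hρ.2.1)
  have h4 : inner ℝ θ (gradient ρ y) ≤ 0 := by
    by_contra h; push Not at h
    have := mul_pos h3 h
    linarith
  nlinarith

/-! ### Supports up to the boundary and extension beyond it -/

/-- The support of a function on `G × S × I°`. -/
def phaseSupport (G : Set V3) (E₀ Eₘ : ℝ) (ψ : Phase → ℝ) : Set Phase :=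
  closure (Function.support ψ ∩ phaseInterior G E₀ Eₘ)

theorem phaseSupport_subset {G : Set V3} {E₀ Eₘ : ℝ} {ψ : Phase → ℝ} :
    phaseSupport G E₀ Eₘ ψ ⊆ closure G ×ˢ (univ ×ˢ Icc E₀ Eₘ) := by
  refine closure_minimal ?_ (isClosed_closure.prod (isClosed_univ.prod isClosed_Icc))
  rintro z ⟨-, hz1, hz2⟩
  exact ⟨subset_closure hz1, mem_univ _, Ioo_subset_Icc_self hz2⟩

theorem IsSmoothStrictlyConvexDomain.isCompact_closed_phase {G : Set V3}
    (hG : IsSmoothStrictlyConvexDomain G) (E₀ Eₘ : ℝ) :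
    IsCompact (closure G ×ˢ ((univ : Set Sph) ×ˢ Icc E₀ Eₘ)) :=
  hG.isBounded.isCompact_closure.prod (isCompact_univ.prod isCompact_Icc)

theorem IsSmoothStrictlyConvexDomain.isCompact_phaseSupport {G : Set V3}
    (hG : IsSmoothStrictlyConvexDomain G) {E₀ Eₘ : ℝ} {ψ : Phase → ℝ} :
    IsCompact (phaseSupport G E₀ Eₘ ψ) :=
  (hG.isCompact_closed_phase E₀ Eₘ).of_isClosed_subset isClosed_closure phaseSupport_subset

/-- A common point would lie on ∂G, since the shadow avoids the open set G. As it is not in Γ₋ ∪ Γ₀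
it is strictly outgoing, and such points are not limits of the shadow. -/
theorem IsSmoothStrictlyConvexDomain.disjoint_backwardShadow {G : Set V3}
    (hG : IsSmoothStrictlyConvexDomain G) {E₀ Eₘ : ℝ} {ψ : Phase → ℝ}
    (hψ : Disjoint (phaseSupport G E₀ Eₘ ψ) (gammaMinusZero G E₀ Eₘ)) :
    Disjoint (phaseSupport G E₀ Eₘ ψ) (closure (backwardShadow G)) := by
  rw [Set.disjoint_left] at hψ ⊢
  intro z hz hz'
  have hout : z.1 ∉ G := by
    have hcl : IsClosed {z : Phase | z.1 ∉ G} :=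
      (hG.isOpen.preimage continuous_fst).isClosed_compl
    exact closure_minimal (fun z hz => hz.1) hcl hz'
  have hfr : z.1 ∈ frontier G := by
    rw [hG.isOpen.frontier_eq]
    exact ⟨(phaseSupport_subset hz).1, hout⟩
  obtain ⟨ρ, hρ⟩ := hG.smooth_boundary _ hfr
  refine hψ hz ⟨hfr, (phaseSupport_subset hz).2.2, _, ⟨ρ, hρ, rfl⟩, ?_⟩
  by_contra h; push Not at h
  refine hG.notMem_closure_backwardShadow hfr hρ ?_ hz'
  rw [inner_smul_right, real_inner_comm] at h
  exact pos_of_mul_pos_right h (inv_nonneg.2 (norm_nonneg _))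

/-- Extension of an inflow-vanishing function to the whole space by a function that vanishes on
the backward shadow of `G`. -/
theorem IsInflowVanishing.exists_extension {G : Set V3} (hG : IsSmoothStrictlyConvexDomain G)
    {E₀ Eₘ : ℝ} {k : ℕ} {ψ : Phase → ℝ} (hψ : IsInflowVanishing G E₀ Eₘ k ψ) :
    ∃ f, IsCxCompact k f ∧ EqOn ψ f (phaseInterior G E₀ Eₘ) ∧ ∀ z ∈ backwardShadow G, f z = 0 := by
  obtain ⟨⟨f, hf, hψf⟩, hd⟩ := hψ
  obtain ⟨χ, hχ, h1, h0⟩ := exists_cutoff isClosed_closure isClosed_closure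
    (hG.disjoint_backwardShadow hd)
  refine ⟨fun z => χ z * f z, IsCxCompact.mul_left (hχ k) hf, fun z hz => ?_, fun z hz => ?_⟩
  · by_cases hz0 : ψ z = 0
    · simp [← hψf hz, hz0]
    · simp only [h1 z (subset_closure ⟨hz0, hz⟩), one_mul, hψf hz]
  · simp [h0 z (subset_closure hz)]

/-! ### The resolvent of the streaming operator -/

/-- The direction field `(ω, E) ↦ ω`. -/
abbrev direction : Sph × ℝ → V3 := fun p => (p.1 : V3)

theorem continuous_direction : Continuous direction := by fun_prop

/-- The solution `∫₀^∞ e^{-Ct} f(x - tω, ω, E) dt` of `ω · ∇ₓ ψ + C ψ = f`. -/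
def resolvent (C : ℝ) (f : Phase → ℝ) : Phase → ℝ := fun z =>
  ∫ t in Ioi (0 : ℝ), Real.exp (-C * t) * f (shift direction t z)

theorem continuous_shift_left (z : Phase) : Continuous fun t : ℝ => shift direction t z :=
  (continuous_shift continuous_direction).comp (by fun_prop : Continuous fun t : ℝ => (t, z))

theorem continuous_shift_right (t : ℝ) : Continuous (shift direction t) :=
  (continuous_shift continuous_direction).comp (by fun_prop : Continuous fun z : Phase => (t, z))

theorem continuous_resolvent_integrand (C : ℝ) {f : Phase → ℝ} (hf : Continuous f) (z : Phase) :
    Continuous fun t : ℝ => Real.exp (-C * t) * f (shift direction t z) :=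
  (by fun_prop : Continuous fun t : ℝ => Real.exp (-C * t)).mul
    (hf.comp (continuous_shift_left z))

theorem norm_resolvent_integrand_le (C : ℝ) {f : Phase → ℝ} {M : ℝ} (hM : ∀ z, ‖f z‖ ≤ M) (t : ℝ)
    (z : Phase) : ‖Real.exp (-C * t) * f z‖ ≤ Real.exp (-C * t) * M := by
  rw [norm_mul, Real.norm_eq_abs, Real.abs_exp]
  exact mul_le_mul_of_nonneg_left (hM z) (Real.exp_pos _).le

theorem integrableOn_exp_mul_const {C : ℝ} (hC : 0 < C) (M : ℝ) :
    IntegrableOn (fun t : ℝ => Real.exp (-C * t) * M) (Ioi 0) :=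
  (exp_neg_integrableOn_Ioi 0 hC).mul_const M

theorem integrableOn_resolvent_integrand {C : ℝ} (hC : 0 < C) {f : Phase → ℝ} (hf : Continuous f)
    (hc : HasCompactSupport f) (z : Phase) :
    IntegrableOn (fun t : ℝ => Real.exp (-C * t) * f (shift direction t z)) (Ioi 0) := by
  obtain ⟨M, hM⟩ := hc.exists_bound_of_continuous hf
  exact (integrableOn_exp_mul_const hC M).mono'
    (continuous_resolvent_integrand C hf z).aestronglyMeasurable
    (.of_forall fun t => norm_resolvent_integrand_le C hM t _)

theorem continuous_resolvent {C : ℝ} (hC : 0 < C) {f : Phase → ℝ} (hf : Continuous f)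
    (hc : HasCompactSupport f) : Continuous (resolvent C f) := by
  obtain ⟨M, hM⟩ := hc.exists_bound_of_continuous hf
  exact continuous_of_dominated
    (fun z => (continuous_resolvent_integrand C hf z).aestronglyMeasurable)
    (fun z => .of_forall fun t => norm_resolvent_integrand_le C hM t _)
    (integrableOn_exp_mul_const hC M)
    (.of_forall fun t => continuous_const.mul (hf.comp (continuous_shift_right t)))

theorem hasLineDerivAt_resolvent {C : ℝ} (hC : 0 < C) {f : Phase → ℝ} (hf : IsCxCompact 1 f)
    (i : Fin 3) (x : V3) (p : Sph × ℝ) :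
    HasLineDerivAt ℝ (fun x => resolvent C f (x, p)) (resolvent C (pd i f) (x, p)) x
      (basisVec i) := by
  have hpd := hf.pd (k := 0) i
  obtain ⟨M, hM⟩ := hpd.2.exists_bound_of_continuous hpd.1.continuous
  have key := hasDerivAt_integral_of_dominated_loc_of_deriv_le
    (μ := volume.restrict (Ioi (0 : ℝ)))
    (F := fun s t => Real.exp (-C * t) * f (shift direction t (x + s • basisVec i, p)))
    (F' := fun s t => Real.exp (-C * t) * pd i f (shift direction t (x + s • basisVec i, p)))
    (x₀ := (0 : ℝ)) (s := univ) (bound := fun t => Real.exp (-C * t) * M) univ_mem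
    (.of_forall fun s => (continuous_resolvent_integrand C hf.1.continuous _).aestronglyMeasurable)
    (integrableOn_resolvent_integrand hC hf.1.continuous hf.2 _)
    (continuous_resolvent_integrand C hpd.1.continuous _).aestronglyMeasurable
    (.of_forall fun t s _ => norm_resolvent_integrand_le C hM t _)
    (integrableOn_exp_mul_const hC M)
    (.of_forall fun t s _ => ?_)
  · simpa only [zero_smul, add_zero] using! key.2
  · have h1 := hf.1.hasFDerivAt (x + s • basisVec i - t • direction p) p
    have h2 : HasDerivAt (fun s : ℝ => x + s • basisVec i - t • direction p)
        ((1 : ℝ) • basisVec i) s :=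
      (((hasDerivAt_id s).smul_const (basisVec i)).const_add x).sub_const _
    have h3 := (h1.comp_hasDerivAt s h2).const_mul (Real.exp (-C * t))
    have h4 : (∑ j, pd j f (x + s • basisVec i - t • direction p, p) •
        (EuclideanSpace.proj j : V3 →L[ℝ] ℝ)) ((1 : ℝ) • basisVec i) =
        pd i f (x + s • basisVec i - t • direction p, p) := by
      rw [sum_apply, Finset.sum_eq_single i]
      · simp
      · intro j _ hj; simp [hj]
      · simp
    rw [h4] at h3
    exact h3

theorem pd_resolvent {C : ℝ} (hC : 0 < C) {f : Phase → ℝ} (hf : IsCxCompact 1 f) (i : Fin 3) :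
    pd i (resolvent C f) = resolvent C (pd i f) :=
  funext fun z => (hasLineDerivAt_resolvent hC hf i z.1 z.2).lineDeriv

theorem IsCxCompact.resolvent {C : ℝ} (hC : 0 < C) {k : ℕ} {f : Phase → ℝ} (hf : IsCxCompact k f) :
    IsCx k (resolvent C f) := by
  induction k generalizing f with
  | zero => exact continuous_resolvent hC hf.1 hf.2
  | succ k ih =>
    exact IsCx.of_hasLineDerivAt (continuous_resolvent hC hf.1.continuous hf.2)
      (fun i x p => hasLineDerivAt_resolvent hC (hf.mono (by omega)) i x p) (fun i => ih (hf.pd i))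

/-- The integrand e^{-Ct}(ω·∇ₓf + Cf)(x - tω) is minus the t-derivative of e^{-Ct} f(x - tω), which
decays at infinity and equals f at t = 0. -/
theorem advect_resolvent {C : ℝ} (hC : 0 < C) {f : Phase → ℝ} (hf : IsCxCompact 1 f) (z : Phase) :
    advect (resolvent C f) z + C * resolvent C f z = f z := by
  have hi := fun i => integrableOn_resolvent_integrand hC (hf.pd (k := 0) i).1.continuous
    (hf.pd (k := 0) i).2 z
  have hi0 := integrableOn_resolvent_integrand hC hf.1.continuous hf.2 z
  have hia := integrableOn_resolvent_integrand hC (hf.advect (k := 0)).1.continuous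
    (hf.advect (k := 0)).2 z
  have h1 : advect (resolvent C f) z =
      ∫ t in Ioi (0 : ℝ), Real.exp (-C * t) * advect f (shift direction t z) := by
    simp only [advect, pd_resolvent hC hf, resolvent, ← integral_const_mul]
    rw [← integral_finsetSum _ fun i _ => (hi i).const_mul _]
    refine integral_congr_ae (.of_forall fun t => ?_)
    simp only [Finset.mul_sum, shift]
    exact Finset.sum_congr rfl fun i _ => by ring
  have hder : ∀ t : ℝ, HasDerivAt (fun t => Real.exp (-C * t) * f (shift direction t z))
      (-(Real.exp (-C * t) * advect f (shift direction t z) +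
        C * (Real.exp (-C * t) * f (shift direction t z)))) t := by
    intro t
    have h2 := hf.1.hasDerivAt_shift direction z t
    have h3 : HasDerivAt (fun t : ℝ => Real.exp (-C * t)) (Real.exp (-C * t) * (-C * 1)) t :=
      ((hasDerivAt_id t).const_mul (-C)).exp
    refine (h3.mul h2).congr_deriv ?_
    rw [dirDeriv_direction]; ring
  have hlim : Tendsto (fun t : ℝ => Real.exp (-C * t) * f (shift direction t z)) atTop (𝓝 0) := by
    obtain ⟨M, hM⟩ := hf.2.exists_bound_of_continuous hf.1.continuous
    refine squeeze_zero_norm (fun t => norm_resolvent_integrand_le C hM t _) ?_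
    have h4 : Tendsto (fun t : ℝ => -C * t) atTop atBot :=
      tendsto_id.const_mul_atTop_of_neg (by linarith)
    simpa using (Real.tendsto_exp_atBot.comp h4).mul_const M
  have h5 := integral_Ioi_of_hasDerivAt_of_tendsto' (a := 0) (fun t _ => hder t)
    (hia.add (hi0.const_mul C)).neg hlim
  rw [integral_neg, integral_add hia (hi0.const_mul C), integral_const_mul, ← h1] at h5
  simp only [mul_zero, Real.exp_zero, one_mul, shift_zero] at h5
  change -(advect (resolvent C f) z + C * resolvent C f z) = _ at h5
  linarith

/-- A backward characteristic from a point over G is at each time either over G, where f = g, or in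
the shadow, where both vanish. So the resolvent does not depend on which extension is used. -/
theorem resolvent_congr {G : Set V3} {E₀ Eₘ : ℝ} {f g : Phase → ℝ} (C : ℝ)
    (h : EqOn f g (phaseInterior G E₀ Eₘ)) (hf : ∀ z ∈ backwardShadow G, f z = 0)
    (hg : ∀ z ∈ backwardShadow G, g z = 0) :
    EqOn (resolvent C f) (resolvent C g) (phaseInterior G E₀ Eₘ) := by
  intro z hz
  refine setIntegral_congr_fun measurableSet_Ioi fun t ht => ?_
  have ht : 0 < t := ht
  by_cases hG : (shift direction t z).1 ∈ G
  · simp only [h (show shift direction t z ∈ phaseInterior G E₀ Eₘ from ⟨hG, hz.2⟩)]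
  · have hB : shift direction t z ∈ backwardShadow G :=
      ⟨hG, t, ht.le, by simpa [shift] using hz.1⟩
    simp only [hf _ hB, hg _ hB]

/-- The equation `ω · ∇ₓ ψ + C ψ = f` is solvable for `C > 0` in the space of smooth functions that
vanish near the inflow boundary. -/
theorem exists_smooth_solution {G : Set V3} (hG : IsSmoothStrictlyConvexDomain G) {E₀ Eₘ : ℝ}
    {C : ℝ} (hC : 0 < C) {f : Phase → ℝ} (hf : f ∈ smoothSpace G E₀ Eₘ) :
    ∃ ψ ∈ smoothSpace G E₀ Eₘ,
      EqOn (fun z => advect ψ z + C * ψ z) f (phaseInterior G E₀ Eₘ) := by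
  -- The extension of f may depend on k. The solution is defined through `F 1`; on G × S × I° it
  -- coincides with the resolvent of `F k`, which supplies k derivatives.
  choose! F hF hfF hF0 using fun k (hk : 1 ≤ k) => (hf k hk).exists_extension hG
  obtain ⟨χ, hχ, hχ1⟩ := exists_compact_cutoff (hG.isCompact_closed_phase E₀ Eₘ)
  have hχi : ∀ z ∈ phaseInterior G E₀ Eₘ, χ z = 1 := fun z hz =>
    hχ1 z ⟨subset_closure hz.1, mem_univ _, Ioo_subset_Icc_self hz.2⟩
  -- The resolvent need not have compact support, since it spreads along forward characteristics;
  -- the factor χ cuts it off without changing it on G × S × I°.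
  refine ⟨resolvent C (F 1), fun k hk => ⟨⟨fun z => resolvent C (F k) z * χ z,
    IsCxCompact.mul_left ((hF k hk).resolvent hC) (hχ k), fun z hz => ?_⟩, ?_⟩, fun z hz => ?_⟩
  · simp only [hχi z hz, mul_one]
    exact resolvent_congr C (fun z hz => (hfF 1 le_rfl hz).symm.trans (hfF k hk hz))
      (hF0 1 le_rfl) (hF0 k hk) hz
  · obtain ⟨R, hR⟩ := Metric.isBounded_iff.1 hG.isBounded
    have hKd := (hf 1 le_rfl).2
    have hK : IsCompact ((fun q : ℝ × Phase => shift direction q.1 q.2) ''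
        (Icc (-R) 0 ×ˢ phaseSupport G E₀ Eₘ f)) :=
      (isCompact_Icc.prod hG.isCompact_phaseSupport).image (continuous_shift continuous_direction)
    -- The solution is supported in the forward flow-out of the support of f. Only times up to the
    -- diameter bound R matter, so the flow-out is compact and contains the closure. Forward motion
    -- is a shift by a negative parameter.
    have hsub : closure (Function.support (resolvent C (F 1)) ∩ phaseInterior G E₀ Eₘ) ⊆
        (fun q : ℝ × Phase => shift direction q.1 q.2) ''
          (Icc (-R) 0 ×ˢ phaseSupport G E₀ Eₘ f) := by
      refine closure_minimal ?_ hK.isClosed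
      rintro z ⟨hz0, hz⟩
      have : ∃ t : ℝ, 0 ≤ t ∧ F 1 (shift direction t z) ≠ 0 := by
        by_contra hcon
        push Not at hcon
        refine hz0 (setIntegral_eq_zero_of_forall_eq_zero fun t ht => ?_)
        rw [hcon t (le_of_lt ht), mul_zero]
      obtain ⟨t, ht, hne⟩ := this
      have hin : shift direction t z ∈ phaseInterior G E₀ Eₘ := by
        refine ⟨?_, hz.2⟩
        by_contra hout
        exact hne (hF0 1 le_rfl _ ⟨hout, t, ht, by simpa [shift] using hz.1⟩)
      refine ⟨(-t, shift direction t z), ⟨⟨?_, by simpa using ht⟩, subset_closure ⟨?_, hin⟩⟩, ?_⟩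
      · have hd := hR hz.1 hin.1
        have hn : ‖(z.2.1 : V3)‖ = 1 := mem_sphere_zero_iff_norm.1 z.2.1.2
        rw [dist_eq_norm, shift, sub_sub_cancel, norm_smul, hn, mul_one, Real.norm_eq_abs,
          abs_of_nonneg ht] at hd
        simp only; linarith
      · rw [Function.mem_support, hfF 1 le_rfl hin]; exact hne
      · simp only [shift_shift, neg_add_cancel, shift_zero]
    rw [Set.disjoint_left] at hKd ⊢
    intro z hz hzg
    obtain ⟨⟨t, z'⟩, ⟨⟨-, ht⟩, hz'⟩, rfl⟩ := hsub hz
    obtain ⟨hfr, hE, n, hn, hle⟩ := hzg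
    have hn1 : ‖(z'.2.1 : V3)‖ = 1 := mem_sphere_zero_iff_norm.1 z'.2.1.2
    have hne : (z'.2.1 : V3) ≠ 0 := by
      intro h; rw [h, norm_zero] at hn1; exact zero_ne_one hn1
    -- A point of the flow-out on Γ₋ ∪ Γ₀ has travelled for time zero, so it already lies in the
    -- support of f, which avoids that set.
    have h0 := hG.eq_zero_of_sub_smul_mem (t := -t) hfr hn hne hle (by simpa using ht)
      (by simpa [shift] using (phaseSupport_subset hz').1)
    have ht0 : t = 0 := by linarith
    subst ht0
    simp only [shift_zero] at hfr hE hn hle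
    exact hKd hz' ⟨hfr, hE, n, hn, hle⟩
  · simp only [advect_resolvent hC (hF 1 le_rfl)]
    exact (hfF 1 le_rfl hz).symm

/-! ### The algebra of smooth functions on three-space -/

/-- The algebra of smooth functions on three-space. -/
def smoothSubalgebra : Subalgebra ℝ (V3 → ℝ) where
  carrier := {g | ContDiff ℝ ∞ g}
  mul_mem' := fun {f g} (hf : ContDiff ℝ ∞ f) (hg : ContDiff ℝ ∞ g) => hf.mul hg
  add_mem' := fun {f g} (hf : ContDiff ℝ ∞ f) (hg : ContDiff ℝ ∞ g) => hf.add hg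
  algebraMap_mem' := fun c => (contDiff_const : ContDiff ℝ ∞ fun _ : V3 => c)

/-- Smooth functions on three-space. -/
abbrev SmoothFn : Type := smoothSubalgebra

theorem SmoothFn.contDiff (g : SmoothFn) : ContDiff ℝ ∞ (g : V3 → ℝ) := g.2

theorem SmoothFn.hasFDerivAt (g : SmoothFn) (x : V3) :
    HasFDerivAt (g : V3 → ℝ) (fderiv ℝ (g : V3 → ℝ) x) x :=
  (g.contDiff.differentiable (by simp) x).hasFDerivAt

/-- The partial derivative of a smooth function. -/
def SmoothFn.D (i : Fin 3) : Module.End ℝ SmoothFn where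
  toFun g := ⟨fun x => fderiv ℝ (g : V3 → ℝ) x (basisVec i),
    (g.contDiff.fderiv_right (m := ∞) (by simp)).clm_apply contDiff_const⟩
  map_add' f g := Subtype.ext <| funext fun x => by
    have := ((f.hasFDerivAt x).add (g.hasFDerivAt x)).fderiv
    change fderiv ℝ ((f : V3 → ℝ) + (g : V3 → ℝ)) x (basisVec i) = _
    rw [this]; rfl
  map_smul' c g := Subtype.ext <| funext fun x => by
    have := ((g.hasFDerivAt x).const_smul c).fderiv
    change fderiv ℝ (c • (g : V3 → ℝ)) x (basisVec i) = _
    rw [this]; rfl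

theorem SmoothFn.D_apply (i : Fin 3) (g : SmoothFn) (x : V3) :
    (SmoothFn.D i g : V3 → ℝ) x = fderiv ℝ (g : V3 → ℝ) x (basisVec i) := rfl

theorem SmoothFn.lineDeriv_eq (i : Fin 3) (g : SmoothFn) (x : V3) :
    lineDeriv ℝ (g : V3 → ℝ) x (basisVec i) = (SmoothFn.D i g : V3 → ℝ) x :=
  (g.contDiff.differentiable (by simp) x).lineDeriv_eq_fderiv

theorem SmoothFn.D_mul (i : Fin 3) (f g : SmoothFn) :
    SmoothFn.D i (f * g) = SmoothFn.D i f * g + f * SmoothFn.D i g :=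
  Subtype.ext <| funext fun x => by
    have := ((f.hasFDerivAt x).mul (g.hasFDerivAt x)).fderiv
    change fderiv ℝ ((f : V3 → ℝ) * (g : V3 → ℝ)) x (basisVec i) = _
    rw [this]
    simp [SmoothFn.D_apply]
    ring

theorem SmoothFn.D_commute (i j : Fin 3) : Commute (SmoothFn.D i) (SmoothFn.D j) :=
  LinearMap.ext fun g => Subtype.ext <| funext fun x => by
    have hd : DifferentiableAt ℝ (fderiv ℝ (g : V3 → ℝ)) x :=
      (g.contDiff.fderiv_right (m := ∞) (by simp)).differentiable (by simp) x
    have hsymm : IsSymmSndFDerivAt ℝ (g : V3 → ℝ) x :=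
      g.contDiff.contDiffAt.isSymmSndFDerivAt
        (by rw [minSmoothness_of_isRCLikeNormedField]; exact WithTop.coe_le_coe.2 le_top)
    have key : ∀ i j, fderiv ℝ (fun y => fderiv ℝ (g : V3 → ℝ) y (basisVec i)) x (basisVec j) =
        fderiv ℝ (fderiv ℝ (g : V3 → ℝ)) x (basisVec j) (basisVec i) := by
      intro i j
      rw [fderiv_clm_apply hd (differentiableAt_const _)]
      simp
    change fderiv ℝ (fun y => fderiv ℝ (g : V3 → ℝ) y (basisVec j)) x (basisVec i) =
      fderiv ℝ (fun y => fderiv ℝ (g : V3 → ℝ) y (basisVec i)) x (basisVec j)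
    rw [key, key, hsymm.eq]

/-- The sum runs to a fixed N ≥ n so that its index set is independent of n. The extra terms have
binomial coefficient zero, and three such sums combine into one over a fixed box. -/
theorem SmoothFn.D_pow_mul (i : Fin 3) (n N : ℕ) (hN : n ≤ N) (f g : SmoothFn) :
    (SmoothFn.D i ^ n) (f * g) = ∑ k ∈ Finset.range (N + 1),
      (n.choose k : ℝ) • ((SmoothFn.D i ^ k) f * (SmoothFn.D i ^ (n - k)) g) := by
  have h1 : (SmoothFn.D i ^ n) (f * g) = ∑ p ∈ Finset.HasAntidiagonal.antidiagonal n,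
      (n.choose p.1 : ℝ) • ((SmoothFn.D i ^ p.1) f * (SmoothFn.D i ^ p.2) g) := by
    clear hN N
    induction n with
    | zero => simp
    | succ n ih =>
      have hX : ∀ k l, SmoothFn.D i ((SmoothFn.D i ^ k) f * (SmoothFn.D i ^ l) g) =
          (SmoothFn.D i ^ (k + 1)) f * (SmoothFn.D i ^ l) g +
            (SmoothFn.D i ^ k) f * (SmoothFn.D i ^ (l + 1)) g := by
        intro k l
        rw [SmoothFn.D_mul]
        simp only [pow_succ', Module.End.mul_apply]
      rw [pow_succ', Module.End.mul_apply, ih, map_sum]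
      simp only [map_smul, hX, smul_add, Finset.sum_add_distrib]
      simp only [Nat.cast_smul_eq_nsmul ℝ]
      rw [Finset.sum_antidiagonal_choose_succ_nsmul
        (f := fun k l => (SmoothFn.D i ^ k) f * (SmoothFn.D i ^ l) g) n, add_comm]
      congr 1
      refine Finset.sum_congr rfl fun p hp => ?_
      rw [Nat.choose_symm_of_eq_add (Finset.HasAntidiagonal.mem_antidiagonal.1 hp).symm]
  rw [h1, Finset.Nat.sum_antidiagonal_eq_sum_range_succ_mk]
  refine Finset.sum_subset (Finset.range_mono (by omega)) fun k _ hk => ?_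
  rw [Nat.choose_eq_zero_of_lt (by simpa using hk), Nat.cast_zero, zero_smul]

/-- The derivative of a smooth function for a multi-index. -/
def SmoothFn.Dm (a : Fin 3 → ℕ) : Module.End ℝ SmoothFn :=
  SmoothFn.D 0 ^ a 0 * (SmoothFn.D 1 ^ a 1 * SmoothFn.D 2 ^ a 2)

theorem SmoothFn.Dm_D (a : Fin 3 → ℕ) (i : Fin 3) (g : SmoothFn) :
    SmoothFn.Dm a (SmoothFn.D i g) = SmoothFn.D i (SmoothFn.Dm a g) := by
  have h : Commute (SmoothFn.Dm a) (SmoothFn.D i) :=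
    ((SmoothFn.D_commute 0 i).pow_left _).mul_left
      (((SmoothFn.D_commute 1 i).pow_left _).mul_left ((SmoothFn.D_commute 2 i).pow_left _))
  exact congrArg (fun T : Module.End ℝ SmoothFn => T g) h.eq

theorem SmoothFn.Dm_mul {a : Fin 3 → ℕ} {N : ℕ} (hN : ∀ i, a i ≤ N) (f g : SmoothFn) :
    SmoothFn.Dm a (f * g) = ∑ b : Fin 3 → Fin (N + 1), ((∏ i, (a i).choose (b i) : ℕ) : ℝ) •
      (SmoothFn.Dm (fun i => b i) f * SmoothFn.Dm (fun i => a i - b i) g) := by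
  let e : (Fin 3 → Fin (N + 1)) ≃ Fin (N + 1) × Fin (N + 1) × Fin (N + 1) :=
    { toFun := fun b => (b 2, b 1, b 0)
      invFun := fun q => ![q.2.2, q.2.1, q.1]
      left_inv := fun b => by ext i; fin_cases i <;> rfl
      right_inv := fun q => rfl }
  rw [← e.symm.sum_comp, Fintype.sum_prod_type]
  simp only [Fintype.sum_prod_type]
  simp only [SmoothFn.Dm, Module.End.mul_apply, SmoothFn.D_pow_mul _ _ N (hN _), map_sum, map_smul,
    Finset.smul_sum, smul_smul, Finset.sum_range]
  refine Finset.sum_congr rfl fun k _ => Finset.sum_congr rfl fun l _ =>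
    Finset.sum_congr rfl fun j _ => ?_
  simp only [Fin.prod_univ_three, Nat.cast_mul]
  change _ = (((a 0).choose j : ℝ) * ((a 1).choose l : ℝ) * ((a 2).choose k : ℝ)) • _
  rw [show ((a 2).choose k : ℝ) * ((a 1).choose l : ℝ) * ((a 0).choose j : ℝ) =
    ((a 0).choose j : ℝ) * ((a 1).choose l : ℝ) * ((a 2).choose k : ℝ) by ring]
  rfl

/-! ### Germs of functions that are smooth in the space variable -/

/-- Near `z`, the function `f` agrees with the smooth function `g` of the space variable. -/
def HasGerm (f : Phase → ℝ) (z : Phase) (g : SmoothFn) : Prop :=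
  (fun x => f (x, z.2)) =ᶠ[𝓝 z.1] (g : V3 → ℝ)

theorem HasGerm.eq {f : Phase → ℝ} {z : Phase} {g : SmoothFn} (h : HasGerm f z g) :
    f z = (g : V3 → ℝ) z.1 := h.self_of_nhds

theorem HasGerm.pd {f : Phase → ℝ} {z : Phase} {g : SmoothFn} (h : HasGerm f z g) (i : Fin 3) :
    HasGerm (pd i f) z (SmoothFn.D i g) := by
  unfold HasGerm at *
  filter_upwards [h.eventually_nhds] with x hx
  rw [← SmoothFn.lineDeriv_eq]
  exact Filter.EventuallyEq.lineDeriv_eq hx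

theorem HasGerm.pd_iterate {f : Phase → ℝ} {z : Phase} {g : SmoothFn} (h : HasGerm f z g)
    (i : Fin 3) (n : ℕ) : HasGerm ((Transport.pd i)^[n] f) z ((SmoothFn.D i ^ n) g) := by
  induction n with
  | zero => exact h
  | succ n ih =>
    rw [Function.iterate_succ_apply', pow_succ', Module.End.mul_apply]
    exact ih.pd i

theorem HasGerm.pdMulti {f : Phase → ℝ} {z : Phase} {g : SmoothFn} (h : HasGerm f z g)
    (a : Fin 3 → ℕ) : HasGerm (pdMulti a f) z (SmoothFn.Dm a g) :=
  ((h.pd_iterate 2 _).pd_iterate 1 _).pd_iterate 0 _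

theorem HasGerm.add {f f' : Phase → ℝ} {z : Phase} {g g' : SmoothFn} (h : HasGerm f z g)
    (h' : HasGerm f' z g') : HasGerm (fun z => f z + f' z) z (g + g') :=
  Filter.EventuallyEq.add h h'

theorem HasGerm.mul {f f' : Phase → ℝ} {z : Phase} {g g' : SmoothFn} (h : HasGerm f z g)
    (h' : HasGerm f' z g') : HasGerm (fun z => f z * f' z) z (g * g') :=
  Filter.EventuallyEq.mul h h'

theorem HasGerm.const_mul {f : Phase → ℝ} {z : Phase} {g : SmoothFn} (h : HasGerm f z g)
    (c : ℝ) : HasGerm (fun z => c * f z) z (c • g) :=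
  Filter.EventuallyEq.const_smul h c

theorem HasGerm.advect {f : Phase → ℝ} {z : Phase} {g : SmoothFn} (h : HasGerm f z g) :
    HasGerm (advect f) z (∑ i, (z.2.1 : V3) i • SmoothFn.D i g) := by
  have := fun i => h.pd i
  unfold HasGerm at *
  filter_upwards [this 0, this 1, this 2] with x h0 h1 h2
  simp only [Transport.advect, Fin.sum_univ_three, h0, h1, h2]
  rfl

theorem HasGerm.congr {f f' : Phase → ℝ} {z : Phase} {g : SmoothFn} (h : HasGerm f z g)
    {U : Set Phase} (hU : IsOpen U) (hz : z ∈ U) (hff : EqOn f' f U) : HasGerm f' z g := by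
  have hc : Continuous fun x' : V3 => ((x', z.2) : Phase) := by fun_prop
  have : (fun x => f' (x, z.2)) =ᶠ[𝓝 z.1] fun x => f (x, z.2) := by
    filter_upwards [(hU.preimage hc).mem_nhds (show z.1 ∈ _ from hz)] with x' hx'
    exact hff hx'
  exact this.trans h

/-- The direction ω is constant in x and partial derivatives of smooth germs commute. This is what
carries accretivity from L² to all orders of derivatives. -/
theorem HasGerm.pdMulti_advect {f : Phase → ℝ} {z : Phase} {g : SmoothFn} (h : HasGerm f z g)
    (a : Fin 3 → ℕ) : Transport.pdMulti a (Transport.advect f) z =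
      Transport.advect (Transport.pdMulti a f) z := by
  rw [(h.advect.pdMulti a).eq, (h.pdMulti a).advect.eq]
  simp only [map_sum, map_smul, SmoothFn.Dm_D]

theorem hasGerm_of_forall_isCx {f : Phase → ℝ} (hf : ∀ k, IsCx k f) (z : Phase) :
    ∃ g, HasGerm f z g :=
  ⟨⟨fun x => f (x, z.2), contDiff_infty.2 fun k => (hf k).contDiff z.2⟩, .refl _ _⟩

/-- A bump supported over G removes the uncontrolled values of ψ outside. The product is then C^k
for each k, with an extension of ψ that may change with k. -/
theorem hasGerm_of_mem_smoothSpace {G : Set V3} (hG : IsOpen G) {E₀ Eₘ : ℝ} {ψ : Phase → ℝ}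
    (hψ : ψ ∈ smoothSpace G E₀ Eₘ) {z : Phase} (hz : z ∈ phaseInterior G E₀ Eₘ) :
    ∃ g, HasGerm ψ z g := by
  obtain ⟨r, hr, hball⟩ := Metric.isOpen_iff.1 hG z.1 hz.1
  let b : ContDiffBump z.1 := ⟨r / 2, r, by positivity, by linarith⟩
  refine ⟨⟨fun x => b x * ψ (x, z.2), contDiff_infty.2 fun k => ?_⟩, ?_⟩
  · obtain ⟨⟨f, hf, hψf⟩, -⟩ := hψ (k + 1) (by omega)
    have heq : (fun x => b x * ψ (x, z.2)) = fun x => b x * f (x, z.2) := by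
      funext x
      by_cases hx : x ∈ Metric.ball z.1 r
      · rw [hψf (show (x, z.2) ∈ phaseInterior G E₀ Eₘ from ⟨hball hx, hz.2⟩)]
      · have : b x = 0 := Function.notMem_support.1 (by rwa [b.support_eq])
        simp [this]
    rw [heq]
    exact b.contDiff.mul (hf.1.pred.contDiff z.2)
  · unfold HasGerm
    filter_upwards [b.eventuallyEq_one] with x hx
    simp [hx]

variable {G : Set V3} {E₀ Eₘ : ℝ} {m : ℕ}

/-! ### The space of smooth functions vanishing near the inflow boundary -/

theorem phaseSupport_eq_zero {ψ : Phase → ℝ} {z : Phase} (hG : IsOpen G)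
    (hz : z ∈ phaseInterior G E₀ Eₘ) (h : z ∉ phaseSupport G E₀ Eₘ ψ) :
    ∃ U, IsOpen U ∧ z ∈ U ∧ EqOn ψ (fun _ => 0) U := by
  refine ⟨phaseInterior G E₀ Eₘ ∩ (phaseSupport G E₀ Eₘ ψ)ᶜ,
    (isOpen_phaseInterior hG _ _).inter isClosed_closure.isOpen_compl, ⟨hz, h⟩, fun z' hz' => ?_⟩
  by_contra hne
  exact hz'.2 (subset_closure ⟨hne, hz'.1⟩)

theorem isInflowVanishing_of_subset {k : ℕ} {ψ ψ' f : Phase → ℝ}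
    (hψ : Disjoint (phaseSupport G E₀ Eₘ ψ) (gammaMinusZero G E₀ Eₘ)) (hf : IsCxCompact k f)
    (heq : EqOn ψ' f (phaseInterior G E₀ Eₘ))
    (hsub : ∀ z ∈ phaseInterior G E₀ Eₘ, z ∉ phaseSupport G E₀ Eₘ ψ → ψ' z = 0) :
    IsInflowVanishing G E₀ Eₘ k ψ' := by
  refine ⟨⟨f, hf, heq⟩, hψ.mono_left (closure_minimal ?_ isClosed_closure)⟩
  rintro z ⟨hz0, hz⟩
  by_contra h
  exact hz0 (hsub z hz h)

theorem smoothSpace_pd (hG : IsOpen G) {ψ : Phase → ℝ} (hψ : ψ ∈ smoothSpace G E₀ Eₘ)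
    (i : Fin 3) : pd i ψ ∈ smoothSpace G E₀ Eₘ := by
  intro k _
  obtain ⟨⟨f, hf, hψf⟩, hd⟩ := hψ (k + 1) (by omega)
  refine isInflowVanishing_of_subset hd (hf.pd i)
    (pd_congr (isOpen_phaseInterior hG _ _) hψf i) fun z hz h => ?_
  obtain ⟨U, hU, hzU, h0⟩ := phaseSupport_eq_zero hG hz h
  rw [pd_congr hU h0 i hzU]
  exact (hasLineDerivAt_const 0 _ _).lineDeriv

theorem smoothSpace_advect (hG : IsOpen G) {ψ : Phase → ℝ} (hψ : ψ ∈ smoothSpace G E₀ Eₘ) :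
    advect ψ ∈ smoothSpace G E₀ Eₘ := by
  intro k _
  obtain ⟨⟨f, hf, hψf⟩, hd⟩ := hψ (k + 1) (by omega)
  refine isInflowVanishing_of_subset hd hf.advect
    (advect_congr (isOpen_phaseInterior hG _ _) hψf) fun z hz h => ?_
  obtain ⟨U, hU, hzU, h0⟩ := phaseSupport_eq_zero hG hz h
  rw [advect_congr hU h0 hzU]
  simp only [advect]
  exact Finset.sum_eq_zero fun i _ => by
    rw [show pd i (fun _ => 0) z = 0 from (hasLineDerivAt_const 0 _ _).lineDeriv, mul_zero]

theorem smoothSpace_pd_iterate (hG : IsOpen G) {ψ : Phase → ℝ} (hψ : ψ ∈ smoothSpace G E₀ Eₘ)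
    (i : Fin 3) (n : ℕ) : (pd i)^[n] ψ ∈ smoothSpace G E₀ Eₘ := by
  induction n with
  | zero => exact hψ
  | succ n ih => rw [Function.iterate_succ_apply']; exact smoothSpace_pd hG ih i

theorem smoothSpace_pdMulti (hG : IsOpen G) {ψ : Phase → ℝ} (hψ : ψ ∈ smoothSpace G E₀ Eₘ)
    (a : Fin 3 → ℕ) : pdMulti a ψ ∈ smoothSpace G E₀ Eₘ :=
  smoothSpace_pd_iterate hG (smoothSpace_pd_iterate hG (smoothSpace_pd_iterate hG hψ _ _) _ _) _ _

theorem smoothSpace_mul_left {ϕ ψ : Phase → ℝ} (hϕ : ∀ k, IsCx k ϕ)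
    (hψ : ψ ∈ smoothSpace G E₀ Eₘ) : (fun z => ϕ z * ψ z) ∈ smoothSpace G E₀ Eₘ := by
  intro k hk
  obtain ⟨⟨f, hf, hψf⟩, hd⟩ := hψ k hk
  refine isInflowVanishing_of_subset hd (IsCxCompact.mul_left (hϕ k) hf)
    (fun z hz => by simp only [hψf hz]) fun z hz h => ?_
  have : ψ z = 0 := by
    by_contra hne
    exact h (subset_closure ⟨hne, hz⟩)
  simp only [this, mul_zero]

theorem smoothSpace_const_mul {ψ : Phase → ℝ} (hψ : ψ ∈ smoothSpace G E₀ Eₘ) (c : ℝ) :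
    (fun z => c * ψ z) ∈ smoothSpace G E₀ Eₘ :=
  smoothSpace_mul_left (fun k => IsCx.of_snd k (b := fun _ => c) continuous_const) hψ

theorem smoothSpace_add {ψ ψ' : Phase → ℝ} (hψ : ψ ∈ smoothSpace G E₀ Eₘ)
    (hψ' : ψ' ∈ smoothSpace G E₀ Eₘ) : (fun z => ψ z + ψ' z) ∈ smoothSpace G E₀ Eₘ := by
  intro k hk
  obtain ⟨⟨f, hf, hψf⟩, hd⟩ := hψ k hk
  obtain ⟨⟨f', hf', hψf'⟩, hd'⟩ := hψ' k hk
  refine ⟨⟨_, hf.add hf', fun z hz => by simp only [hψf hz, hψf' hz]⟩, ?_⟩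
  refine (hd.union_left hd').mono_left ?_
  rw [← closure_union]
  refine closure_mono ?_
  rintro z ⟨hz0, hz⟩
  by_cases h : ψ z = 0
  · refine Or.inr ⟨fun h' => hz0 ?_, hz⟩
    simp [h, h']
  · exact Or.inl ⟨h, hz⟩

theorem smoothSpace_zero : (fun _ => 0) ∈ smoothSpace G E₀ Eₘ := by
  intro k _
  refine ⟨⟨fun _ => 0, ⟨IsCx.zero k, ?_⟩, fun _ _ => rfl⟩, ?_⟩
  · exact HasCompactSupport.zero
  · simp

theorem memLp_of_isCxCompact {f : Phase → ℝ} (hf : IsCxCompact 0 f) :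
    MemLp f 2 (phaseMeasure G E₀ Eₘ) :=
  hf.1.continuous.memLp_of_hasCompactSupport hf.2

theorem memLp_of_mem_smoothSpace (hG : IsOpen G) {ψ : Phase → ℝ}
    (hψ : ψ ∈ smoothSpace G E₀ Eₘ) : MemLp ψ 2 (phaseMeasure G E₀ Eₘ) := by
  obtain ⟨⟨f, hf, hψf⟩, -⟩ := hψ 1 le_rfl
  refine (memLp_congr_ae ?_).2 (memLp_of_isCxCompact (hf.mono zero_le_one))
  filter_upwards [ae_mem_phaseInterior hG E₀ Eₘ] with z hz using hψf hz

/-! ### Jets -/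

/-- The exponents of a multi-index. -/
abbrev MultiIndex.exps (α : MultiIndex m) : Fin 3 → ℕ := fun i => (α.1 i : ℕ)

theorem exists_isL2Jet (hG : IsOpen G) {ψ : Phase → ℝ} (hψ : ψ ∈ smoothSpace G E₀ Eₘ) :
    ∃ u : L2Jet m G E₀ Eₘ, IsL2Jet ψ u :=
  ⟨WithLp.toLp 2 fun α => (memLp_of_mem_smoothSpace hG (smoothSpace_pdMulti hG hψ α.exps)).toLp _,
    fun α => (memLp_of_mem_smoothSpace hG (smoothSpace_pdMulti hG hψ α.exps)).coeFn_toLp⟩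

theorem IsL2Jet.unique {ψ : Phase → ℝ} {u v : L2Jet m G E₀ Eₘ} (hu : IsL2Jet ψ u)
    (hv : IsL2Jet ψ v) : u = v :=
  PiLp.ext fun α => Lp.ext ((hu α).trans (hv α).symm)

theorem IsL2Jet.of_ae {ψ : Phase → ℝ} {u : L2Jet m G E₀ Eₘ} (hG : IsOpen G)
    (h : ∀ α : MultiIndex m, ∀ᵐ z ∂(phaseMeasure G E₀ Eₘ), z ∈ phaseInterior G E₀ Eₘ →
      u α z = pdMulti α.exps ψ z) : IsL2Jet ψ u := fun α => by
  filter_upwards [h α, ae_mem_phaseInterior hG E₀ Eₘ] with z hz hzi using hz hzi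

theorem pdMulti_congr (hG : IsOpen G) {ψ ψ' : Phase → ℝ} (hψ : ψ ∈ smoothSpace G E₀ Eₘ)
    (h : EqOn ψ' ψ (phaseInterior G E₀ Eₘ)) (a : Fin 3 → ℕ) :
    EqOn (pdMulti a ψ') (pdMulti a ψ) (phaseInterior G E₀ Eₘ) := fun z hz => by
  obtain ⟨g, hg⟩ := hasGerm_of_mem_smoothSpace hG hψ hz
  rw [(hg.pdMulti a).eq, ((hg.congr (isOpen_phaseInterior hG _ _) hz h).pdMulti a).eq]

theorem IsL2Jet.congr (hG : IsOpen G) {ψ ψ' : Phase → ℝ} (hψ : ψ ∈ smoothSpace G E₀ Eₘ)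
    (h : EqOn ψ' ψ (phaseInterior G E₀ Eₘ)) {u : L2Jet m G E₀ Eₘ} (hu : IsL2Jet ψ u) :
    IsL2Jet ψ' u :=
  IsL2Jet.of_ae hG fun α => by
    filter_upwards [hu α] with z hz hzi
    rw [hz, pdMulti_congr hG hψ h _ hzi]

theorem IsL2Jet.add (hG : IsOpen G) {ψ ψ' : Phase → ℝ} {u u' : L2Jet m G E₀ Eₘ}
    (hψ : ψ ∈ smoothSpace G E₀ Eₘ) (hψ' : ψ' ∈ smoothSpace G E₀ Eₘ) (hu : IsL2Jet ψ u)
    (hu' : IsL2Jet ψ' u') : IsL2Jet (fun z => ψ z + ψ' z) (u + u') :=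
  IsL2Jet.of_ae hG fun α => by
    filter_upwards [hu α, hu' α, Lp.coeFn_add (u α) (u' α)] with z h1 h2 h3 hz
    obtain ⟨g, hg⟩ := hasGerm_of_mem_smoothSpace hG hψ hz
    obtain ⟨g', hg'⟩ := hasGerm_of_mem_smoothSpace hG hψ' hz
    rw [((hg.add hg').pdMulti _).eq, PiLp.add_apply, h3, Pi.add_apply, h1, h2, map_add,
      (hg.pdMulti α.exps).eq, (hg'.pdMulti α.exps).eq]
    rfl

theorem IsL2Jet.smul (hG : IsOpen G) {ψ : Phase → ℝ} {u : L2Jet m G E₀ Eₘ}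
    (hψ : ψ ∈ smoothSpace G E₀ Eₘ) (hu : IsL2Jet ψ u) (c : ℝ) :
    IsL2Jet (fun z => c * ψ z) (c • u) :=
  IsL2Jet.of_ae hG fun α => by
    filter_upwards [hu α, Lp.coeFn_smul c (u α)] with z h1 h3 hz
    obtain ⟨g, hg⟩ := hasGerm_of_mem_smoothSpace hG hψ hz
    rw [((hg.const_mul c).pdMulti _).eq, PiLp.smul_apply, h3, Pi.smul_apply, h1, map_smul,
      (hg.pdMulti α.exps).eq]
    rfl

theorem IsL2Jet.zero (hG : IsOpen G) : IsL2Jet (fun _ => 0) (0 : L2Jet m G E₀ Eₘ) := by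
  obtain ⟨u, hu⟩ := exists_isL2Jet (m := m) hG (smoothSpace_zero (G := G) (E₀ := E₀) (Eₘ := Eₘ))
  have h := hu.smul hG smoothSpace_zero 0
  simpa only [zero_smul, mul_zero] using h

/-- The jets of smooth functions that vanish near the inflow boundary. -/
def smoothJets (hG : IsOpen G) : Submodule ℝ (L2Jet m G E₀ Eₘ) where
  carrier := {u | ∃ ψ ∈ smoothSpace G E₀ Eₘ, IsL2Jet ψ u}
  add_mem' := fun ⟨_, hψ, hu⟩ ⟨_, hψ', hu'⟩ => ⟨_, smoothSpace_add hψ hψ', hu.add hG hψ hψ' hu'⟩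
  zero_mem' := ⟨_, smoothSpace_zero, IsL2Jet.zero hG⟩
  smul_mem' := fun c _ ⟨_, hψ, hu⟩ => ⟨_, smoothSpace_const_mul hψ c, hu.smul hG hψ c⟩

/-- The space `H0` as a submodule. -/
def H0Submodule (hG : IsOpen G) : Submodule ℝ (L2Jet m G E₀ Eₘ) :=
  (smoothJets hG).topologicalClosure

/-! ### Multiplication of jets -/

/-- The truncated difference of multi-indices. -/
def MultiIndex.sub (α β : MultiIndex m) : MultiIndex m :=
  ⟨fun i => ⟨α.1 i - β.1 i, by omega⟩,
    (Finset.sum_le_sum fun _ _ => Nat.sub_le _ _).trans α.2⟩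

/-- The coefficients of the Leibniz formula. -/
def leibnizCoeff (α β : MultiIndex m) : ℝ := ((∏ i, (α.exps i).choose (β.exps i) : ℕ) : ℝ)

theorem leibnizCoeff_nonneg (α β : MultiIndex m) : 0 ≤ leibnizCoeff α β := Nat.cast_nonneg _

/-- The constant in the estimate of a product. -/
def leibnizConst (m : ℕ) : ℝ := ∑ α : MultiIndex m, ∑ β : MultiIndex m, leibnizCoeff α β

theorem leibnizConst_nonneg : 0 ≤ leibnizConst m :=
  Finset.sum_nonneg fun _ _ => Finset.sum_nonneg fun _ _ => leibnizCoeff_nonneg _ _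

/-- The product of an essentially bounded and a square integrable function. -/
def prodL2 (μ : Measure Phase) : Lp ℝ ∞ μ →L[ℝ] Lp ℝ 2 μ →L[ℝ] Lp ℝ 2 μ :=
  (ContinuousLinearMap.mul ℝ ℝ).holderL μ ∞ 2 2

theorem coeFn_prodL2 {μ : Measure Phase} (f : Lp ℝ ∞ μ) (g : Lp ℝ 2 μ) :
    prodL2 μ f g =ᵐ[μ] fun z => f z * g z :=
  (ContinuousLinearMap.mul ℝ ℝ).coeFn_holder (r := 2) f g

theorem norm_prodL2_le {μ : Measure Phase} (f : Lp ℝ ∞ μ) (g : Lp ℝ 2 μ) :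
    ‖prodL2 μ f g‖ ≤ ‖f‖ * ‖g‖ := by
  have h := (ContinuousLinearMap.mul ℝ ℝ).norm_holder_apply_apply_le (r := 2) f g
  have h1 : ‖ContinuousLinearMap.mul ℝ ℝ‖ ≤ 1 := ContinuousLinearMap.opNorm_mul_le ℝ ℝ
  refine h.trans ?_
  rw [mul_assoc]
  exact mul_le_of_le_one_left (by positivity) h1

theorem norm_toLp_le_sum (x : MultiIndex m → Lp ℝ 2 (phaseMeasure G E₀ Eₘ)) :
    ‖(WithLp.toLp 2 x : L2Jet m G E₀ Eₘ)‖ ≤ ∑ α, ‖x α‖ := by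
  rw [PiLp.norm_eq_of_L2]
  refine Real.sqrt_le_iff.2 ⟨Finset.sum_nonneg fun _ _ => norm_nonneg _, ?_⟩
  exact Finset.sum_sq_le_sq_sum_of_nonneg fun i _ => norm_nonneg _

/-- The components of the product of two jets, given by the Leibniz formula. -/
def jetMulFun (s : LinftyJet m G E₀ Eₘ) (u : L2Jet m G E₀ Eₘ) : L2Jet m G E₀ Eₘ :=
  WithLp.toLp 2 fun α => ∑ β, leibnizCoeff α β • prodL2 _ (s β) (u (α.sub β))

theorem norm_jetMulFun_le (s : LinftyJet m G E₀ Eₘ) (u : L2Jet m G E₀ Eₘ) :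
    ‖jetMulFun s u‖ ≤ leibnizConst m * ‖s‖ * ‖u‖ := by
  refine (norm_toLp_le_sum _).trans ?_
  rw [leibnizConst, mul_assoc, Finset.sum_mul]
  refine Finset.sum_le_sum fun α _ => ?_
  rw [Finset.sum_mul]
  refine (norm_sum_le _ _).trans (Finset.sum_le_sum fun β _ => ?_)
  rw [norm_smul, Real.norm_of_nonneg (leibnizCoeff_nonneg α β)]
  refine mul_le_mul_of_nonneg_left ((norm_prodL2_le _ _).trans ?_) (leibnizCoeff_nonneg α β)
  exact mul_le_mul (norm_le_pi_norm s β) (PiLp.norm_apply_le u _) (norm_nonneg _) (norm_nonneg _)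

/-- The product of jets as a bounded bilinear map. -/
def jetMul : LinftyJet m G E₀ Eₘ →L[ℝ] L2Jet m G E₀ Eₘ →L[ℝ] L2Jet m G E₀ Eₘ :=
  LinearMap.mkContinuous₂
    (LinearMap.mk₂ ℝ jetMulFun
      (fun s s' u => PiLp.ext fun α => by
        simp [jetMulFun, Finset.sum_add_distrib])
      (fun c s u => PiLp.ext fun α => by
        simp [jetMulFun, Finset.smul_sum, smul_comm c])
      (fun s u u' => PiLp.ext fun α => by
        simp [jetMulFun, Finset.sum_add_distrib])
      (fun c s u => PiLp.ext fun α => by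
        simp [jetMulFun, Finset.smul_sum, smul_comm c]))
    (leibnizConst m) norm_jetMulFun_le

theorem jetMul_apply (s : LinftyJet m G E₀ Eₘ) (u : L2Jet m G E₀ Eₘ) (α : MultiIndex m) :
    jetMul s u α = ∑ β, leibnizCoeff α β • prodL2 _ (s β) (u (α.sub β)) := rfl

theorem norm_jetMul_le (s : LinftyJet m G E₀ Eₘ) (u : L2Jet m G E₀ Eₘ) :
    ‖jetMul s u‖ ≤ leibnizConst m * ‖s‖ * ‖u‖ := norm_jetMulFun_le s u

theorem coeFn_jetMul (s : LinftyJet m G E₀ Eₘ) (u : L2Jet m G E₀ Eₘ) (α : MultiIndex m) :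
    jetMul s u α =ᵐ[phaseMeasure G E₀ Eₘ]
      fun z => ∑ β, leibnizCoeff α β * (s β z * u (α.sub β) z) := by
  rw [jetMul_apply]
  refine (Lp.coeFn_finsetSum _ _).trans ?_
  have h : ∀ β : MultiIndex m, ∀ᵐ z ∂(phaseMeasure G E₀ Eₘ),
      (leibnizCoeff α β • prodL2 _ (s β) (u (α.sub β)) : Lp ℝ 2 (phaseMeasure G E₀ Eₘ)) z =
        leibnizCoeff α β * (s β z * u (α.sub β) z) := fun β => by
    filter_upwards [Lp.coeFn_smul (leibnizCoeff α β) (prodL2 _ (s β) (u (α.sub β))),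
      coeFn_prodL2 (s β) (u (α.sub β))] with z h1 h2
    rw [h1, Pi.smul_apply, h2, smul_eq_mul]
  filter_upwards [ae_all_iff.2 h] with z hz
  rw [Finset.sum_apply]
  exact Finset.sum_congr rfl fun β _ => hz β

theorem coeFn_jetMul_zero (s : LinftyJet m G E₀ Eₘ) (u : L2Jet m G E₀ Eₘ) :
    jetMul s u (zeroIndex m) =ᵐ[phaseMeasure G E₀ Eₘ]
      fun z => s (zeroIndex m) z * u (zeroIndex m) z := by
  refine (coeFn_jetMul s u _).trans (.of_forall fun z => ?_)
  simp only
  rw [Finset.sum_eq_single (zeroIndex m)]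
  · have h1 : leibnizCoeff (zeroIndex m) (zeroIndex m) = 1 := by simp [leibnizCoeff, zeroIndex]
    have h2 : (zeroIndex m).sub (zeroIndex m) = zeroIndex m := by
      simp [MultiIndex.sub, zeroIndex]
    rw [h1, h2, one_mul]
  · intro β _ hβ
    have h1 : leibnizCoeff (zeroIndex m) β = 0 := by
      have : ∃ i, β.exps i ≠ 0 := by
        by_contra hcon
        push Not at hcon
        exact hβ (Subtype.ext <| funext fun i => Fin.ext (hcon i))
      obtain ⟨i, hi⟩ := this
      rw [leibnizCoeff, Finset.prod_eq_zero (Finset.mem_univ i), Nat.cast_zero]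
      exact Nat.choose_eq_zero_of_lt (by simpa [zeroIndex] using Nat.pos_of_ne_zero hi)
    rw [h1, zero_mul]
  · simp

/-- The Leibniz formula for the derivatives of a product. -/
theorem pdMulti_mul {f f' : Phase → ℝ} {z : Phase} {g g' : SmoothFn} (h : HasGerm f z g)
    (h' : HasGerm f' z g') (α : MultiIndex m) :
    pdMulti α.exps (fun z => f z * f' z) z =
      ∑ β, leibnizCoeff α β * (pdMulti β.exps f z * pdMulti (α.sub β).exps f' z) := by
  have hN : ∀ i, α.exps i ≤ m := fun i => Nat.lt_succ_iff.1 (α.1 i).2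
  rw [((h.mul h').pdMulti _).eq, SmoothFn.Dm_mul hN]
  have h1 : ∀ β : MultiIndex m, leibnizCoeff α β *
      (pdMulti β.exps f z * pdMulti (α.sub β).exps f' z) =
      ((∏ i, (α.exps i).choose (β.1 i) : ℕ) : ℝ) *
        ((SmoothFn.Dm (fun i => β.1 i) g : V3 → ℝ) z.1 *
          (SmoothFn.Dm (fun i => α.exps i - β.1 i) g' : V3 → ℝ) z.1) := fun β => by
    rw [(h.pdMulti _).eq, (h'.pdMulti _).eq]; rfl
  simp only [h1]
  rw [← Finset.sum_subtype (Finset.univ.filter fun b : Fin 3 → Fin (m + 1) => ∑ i, (b i : ℕ) ≤ m)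
    (by simp) (fun b => ((∏ i, (α.exps i).choose (b i) : ℕ) : ℝ) *
        ((SmoothFn.Dm (fun i => b i) g : V3 → ℝ) z.1 *
          (SmoothFn.Dm (fun i => α.exps i - b i) g' : V3 → ℝ) z.1))]
  -- The sum over |b| ≤ m may be enlarged to the whole box: if |b| > m ≥ |α|, some b_i exceeds α_i
  -- and the coefficient vanishes.
  rw [Finset.sum_subset (Finset.filter_subset _ _) (fun b _ hb => ?_)]
  · rw [AddSubmonoidClass.coe_finsetSum, Finset.sum_apply]
    rfl
  · have hlt : ∃ i, α.exps i < (b i : ℕ) := by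
      by_contra hcon
      push Not at hcon
      exact hb (Finset.mem_filter.2 ⟨Finset.mem_univ _,
        (Finset.sum_le_sum fun i _ => hcon i).trans α.2⟩)
    obtain ⟨i, hi⟩ := hlt
    rw [Finset.prod_eq_zero (Finset.mem_univ i) (Nat.choose_eq_zero_of_lt hi), Nat.cast_zero,
      zero_mul]

theorem IsL2Jet.mul (hG : IsOpen G) {ϕ ψ : Phase → ℝ} {s : LinftyJet m G E₀ Eₘ}
    {u : L2Jet m G E₀ Eₘ} (hϕ : ∀ k, IsCx k ϕ) (hs : IsLinftyJet ϕ s)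
    (hψ : ψ ∈ smoothSpace G E₀ Eₘ) (hu : IsL2Jet ψ u) :
    IsL2Jet (fun z => ϕ z * ψ z) (jetMul s u) :=
  IsL2Jet.of_ae hG fun α => by
    filter_upwards [coeFn_jetMul s u α, ae_all_iff.2 hs, ae_all_iff.2 hu] with z h1 h2 h3 hz
    obtain ⟨g, hg⟩ := hasGerm_of_forall_isCx hϕ z
    obtain ⟨g', hg'⟩ := hasGerm_of_mem_smoothSpace hG hψ hz
    rw [h1, pdMulti_mul hg hg']
    exact Finset.sum_congr rfl fun β _ => by rw [h2, h3]

/-- `H0` is stable under multiplication by coefficients. -/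
theorem jetMul_mem_H0 (hG : IsOpen G) {s : LinftyJet m G E₀ Eₘ} {u : L2Jet m G E₀ Eₘ}
    (hs : s ∈ coeffSpace m G E₀ Eₘ) (hu : u ∈ H0 m G E₀ Eₘ) : jetMul s u ∈ H0 m G E₀ Eₘ := by
  refine map_mem_closure₂ (f := fun s u => jetMul s u)
    ((jetMul (m := m)).continuous₂) hs hu ?_
  rintro s ⟨ϕ, hϕ, hs⟩ u ⟨ψ, hψ, hu⟩
  exact ⟨_, smoothSpace_mul_left (fun k => (hϕ k).1) hψ, hu.mul hG (fun k => (hϕ k).1) hs hψ⟩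

/-! ### Integration by parts and weak derivatives -/

theorem dirDeriv_mul {f g : Phase → ℝ} (hf : IsCx 1 f) (hg : IsCx 1 g) (v : Sph × ℝ → V3)
    (z : Phase) : dirDeriv v (fun z => f z * g z) z = dirDeriv v f z * g z + f z * dirDeriv v g z := by
  simp only [dirDeriv, pd_mul hf hg, Fin.sum_univ_three]
  ring

theorem integral_dirDeriv_mul (G : Set V3) (E₀ Eₘ : ℝ) {v : Sph × ℝ → V3} (hv : Continuous v)
    {f φ : Phase → ℝ} (hf : IsCx 1 f) (hφ : IsCxCompact 1 φ) (hG : ∀ z ∈ tsupport φ, z.1 ∈ G) :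
    ∫ z, dirDeriv v f z * φ z ∂(phaseMeasure G E₀ Eₘ) =
      -∫ z, f z * dirDeriv v φ z ∂(phaseMeasure G E₀ Eₘ) := by
  have h0 := integral_dirDeriv_phase_eq_zero E₀ Eₘ hv (IsCxCompact.mul_left hf hφ)
    (G := G) fun z hz => hG z (closure_mono (Function.support_mul_subset_right _ _) hz)
  simp only [dirDeriv_mul hf hφ.1] at h0
  rw [integral_add] at h0
  · linarith
  · exact ((hf.continuous_dirDeriv hv).mul hφ.1.continuous).integrable_of_hasCompactSupport
      hφ.2.mul_left
  · exact (hf.continuous.mul (hφ.1.continuous_dirDeriv hv)).integrable_of_hasCompactSupport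
      (HasCompactSupport.mul_left (HasCompactSupport.intro hφ.2 (dirDeriv_eq_zero v)))

/-- Test functions on the phase space whose support lies over `G`. -/
structure IsTest (G : Set V3) (φ : Phase → ℝ) : Prop where
  isCxCompact : ∀ k, IsCxCompact k φ
  tsupport_subset : ∀ z ∈ tsupport φ, z.1 ∈ G

theorem IsTest.pd {φ : Phase → ℝ} (hφ : IsTest G φ) (i : Fin 3) : IsTest G (pd i φ) :=
  ⟨fun k => (hφ.isCxCompact (k + 1)).pd i, fun z hz => hφ.tsupport_subset z <|
    closure_minimal (fun z hz => not_imp_comm.1 (pd_eq_zero i z) hz) (isClosed_tsupport φ) hz⟩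

theorem IsTest.pd_iterate {φ : Phase → ℝ} (hφ : IsTest G φ) (i : Fin 3) (n : ℕ) :
    IsTest G ((Transport.pd i)^[n] φ) := by
  induction n with
  | zero => exact hφ
  | succ n ih => rw [Function.iterate_succ_apply']; exact ih.pd i

theorem IsCx.pd_iterate {k n : ℕ} {f : Phase → ℝ} (hf : IsCx (k + n) f) (i : Fin 3) :
    IsCx k ((Transport.pd i)^[n] f) := by
  induction n generalizing f with
  | zero => exact hf
  | succ n ih => rw [Function.iterate_succ_apply]; exact ih (hf.pd i)

theorem integral_pd_iterate_mul (E₀ Eₘ : ℝ) {φ : Phase → ℝ} (hφ : IsTest G φ) (i : Fin 3) {n : ℕ}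
    {f : Phase → ℝ} (hf : IsCx n f) :
    ∫ z, (pd i)^[n] f z * φ z ∂(phaseMeasure G E₀ Eₘ) =
      (-1) ^ n * ∫ z, f z * (pd i)^[n] φ z ∂(phaseMeasure G E₀ Eₘ) := by
  induction n generalizing f with
  | zero => simp
  | succ n ih =>
    have hT := hφ.pd_iterate i n
    have h := integral_dirDeriv_mul G E₀ Eₘ (v := fun _ => basisVec i) continuous_const
      (hf.mono (by omega : 1 ≤ n + 1)) (hT.isCxCompact 1) hT.tsupport_subset
    rw [dirDeriv_basisVec, dirDeriv_basisVec] at h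
    rw [Function.iterate_succ_apply, ih (hf.pd i), h, Function.iterate_succ_apply']
    ring

theorem integral_congr_phaseInterior (hG : IsOpen G) {f g : Phase → ℝ}
    (h : EqOn f g (phaseInterior G E₀ Eₘ)) :
    ∫ z, f z ∂(phaseMeasure G E₀ Eₘ) = ∫ z, g z ∂(phaseMeasure G E₀ Eₘ) :=
  integral_congr_ae (by filter_upwards [ae_mem_phaseInterior hG E₀ Eₘ] with z hz using h hz)

/-- The transposed derivative of a test function. -/
theorem exists_adjoint_test (hG : IsOpen G) {φ : Phase → ℝ} (hφ : IsTest G φ) (a : Fin 3 → ℕ) :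
    ∃ φ', IsCxCompact 0 φ' ∧ ∀ ψ ∈ smoothSpace G E₀ Eₘ,
      ∫ z, pdMulti a ψ z * φ z ∂(phaseMeasure G E₀ Eₘ) =
        ∫ z, ψ z * φ' z ∂(phaseMeasure G E₀ Eₘ) := by
  have h0 := hφ.pd_iterate 0 (a 0)
  have h1 := h0.pd_iterate 1 (a 1)
  have h2 := h1.pd_iterate 2 (a 2)
  refine ⟨fun z => ((-1) ^ a 0 * ((-1) ^ a 1 * (-1) ^ a 2)) *
      (pd 2)^[a 2] ((pd 1)^[a 1] ((pd 0)^[a 0] φ)) z,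
    ⟨(h2.isCxCompact 0).1.const_mul _, (h2.isCxCompact 0).2.mul_left⟩, fun ψ hψ => ?_⟩
  obtain ⟨⟨f, hf, hψf⟩, -⟩ := hψ (a 0 + a 1 + a 2 + 1) (by omega)
  have hf := hf.1.pred
  have hpd : EqOn (pdMulti a ψ) (pdMulti a f) (phaseInterior G E₀ Eₘ) := by
    have hU := isOpen_phaseInterior hG E₀ Eₘ
    have hit : ∀ (i : Fin 3) (n : ℕ) {f g : Phase → ℝ}, EqOn f g (phaseInterior G E₀ Eₘ) →
        EqOn ((pd i)^[n] f) ((pd i)^[n] g) (phaseInterior G E₀ Eₘ) := by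
      intro i n
      induction n with
      | zero => exact fun h => h
      | succ n ih => exact fun h => ih (pd_congr hU h i)
    exact hit 0 _ (hit 1 _ (hit 2 _ hψf))
  rw [integral_congr_phaseInterior hG (fun z hz => by simp only [hpd hz] :
      EqOn (fun z => pdMulti a ψ z * φ z) (fun z => pdMulti a f z * φ z) _),
    integral_congr_phaseInterior hG (fun z hz => by simp only [hψf hz] :
      EqOn (fun z => ψ z * ((-1) ^ a 0 * ((-1) ^ a 1 * (-1) ^ a 2) *
        (pd 2)^[a 2] ((pd 1)^[a 1] ((pd 0)^[a 0] φ)) z)) (fun z => f z *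
        ((-1) ^ a 0 * ((-1) ^ a 1 * (-1) ^ a 2) *
        (pd 2)^[a 2] ((pd 1)^[a 1] ((pd 0)^[a 0] φ)) z)) _)]
  simp only [pdMulti]
  have hf2 : IsCx (a 0 + a 1) ((pd 2)^[a 2] f) := hf.pd_iterate 2
  have hf1 : IsCx (a 0) ((pd 1)^[a 1] ((pd 2)^[a 2] f)) := hf2.pd_iterate 1
  rw [integral_pd_iterate_mul E₀ Eₘ hφ 0 hf1,
    integral_pd_iterate_mul E₀ Eₘ h0 1 (hf2.mono (by omega)),
    integral_pd_iterate_mul E₀ Eₘ h1 2 (hf.mono (by omega)), ← mul_assoc, ← mul_assoc,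
    ← integral_const_mul]
  refine integral_congr_ae (.of_forall fun z => ?_)
  simp only
  ring

/-- The pairing is an L² inner product. Integral identities against test functions thus define
closed sets of jets and pass from 𝒟 to its closures. -/
theorem continuous_integral_mul {μ : Measure Phase} {φ : Phase → ℝ} (hφ : MemLp φ 2 μ) :
    Continuous fun w : Lp ℝ 2 μ => ∫ z, w z * φ z ∂μ := by
  have h : (fun w : Lp ℝ 2 μ => ∫ z, w z * φ z ∂μ) = fun w => inner ℝ (hφ.toLp φ) w := by
    funext w
    rw [L2.inner_def]
    refine integral_congr_ae ?_
    filter_upwards [hφ.coeFn_toLp] with z hz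
    simp [hz]
  rw [h]
  exact continuous_const.inner continuous_id

theorem isFiniteMeasure_phaseMeasure (hG : Bornology.IsBounded G) (E₀ Eₘ : ℝ) :
    IsFiniteMeasure (phaseMeasure G E₀ Eₘ) := by
  have : IsFiniteMeasure ((volume : Measure V3).restrict G) :=
    ⟨by rw [Measure.restrict_apply_univ]; exact hG.measure_lt_top⟩
  unfold phaseMeasure
  infer_instance

/-- The fundamental lemma of the calculus of variations on the phase space. -/
theorem eq_zero_of_integral_test_eq_zero (hG : IsSmoothStrictlyConvexDomain G)
    (w : Lp ℝ 2 (phaseMeasure G E₀ Eₘ))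
    (hw : ∀ φ, IsTest G φ → ∫ z, w z * φ z ∂(phaseMeasure G E₀ Eₘ) = 0) : w = 0 := by
  have := isFiniteMeasure_phaseMeasure hG.isBounded E₀ Eₘ
  have hemb : MeasurableEmbedding toAmbient := isClosedEmbedding_toAmbient.measurableEmbedding
  -- The problem is moved to the ambient linear space with the image measure. Only the values of W
  -- on the image of the phase space matter there.
  set W : Ambient → ℝ := Function.extend toAmbient w 0
  have hW : ∀ z, W (toAmbient z) = w z := fun z =>
    isClosedEmbedding_toAmbient.injective.extend_apply _ _ _
  have hint : Integrable W ((phaseMeasure G E₀ Eₘ).map toAmbient) := by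
    rw [hemb.integrable_map_iff]
    refine ((Lp.memLp w).integrable one_le_two).congr (.of_forall fun z => (hW z).symm)
  have hU : IsOpen {p : Ambient | p.1 ∈ G} := hG.isOpen.preimage continuous_fst
  have key := hU.ae_eq_zero_of_integral_contDiff_smul_eq_zero
    (hint.locallyIntegrable.locallyIntegrableOn _) fun g hg hgc hgU => by
      rw [hemb.integral_map]
      have hφ : IsTest G fun z => g (toAmbient z) :=
        ⟨fun k => ⟨IsCx.of_contDiff k hg, hgc.comp_isClosedEmbedding isClosedEmbedding_toAmbient⟩,
          fun z hz => hgU (tsupport_comp_subset_preimage g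
            isClosedEmbedding_toAmbient.continuous hz)⟩
      rw [← hw _ hφ]
      exact integral_congr_ae (.of_forall fun z => by simp [hW, mul_comm])
  rw [hemb.ae_map_iff] at key
  refine Lp.ext ?_
  filter_upwards [key, ae_mem_phaseInterior hG.isOpen E₀ Eₘ, Lp.coeFn_zero ℝ 2 (phaseMeasure G E₀ Eₘ)]
    with z h1 h2 h3
  rw [← hW, h1 h2.1, h3, Pi.zero_apply]

/-- An element of `H0` is determined by its component with index zero. -/
theorem eq_zero_of_apply_zeroIndex (hG : IsSmoothStrictlyConvexDomain G) {u : L2Jet m G E₀ Eₘ}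
    (hu : u ∈ H0 m G E₀ Eₘ) (h0 : u (zeroIndex m) = 0) : u = 0 := by
  refine PiLp.ext fun α => eq_zero_of_integral_test_eq_zero hG _ fun φ hφ => ?_
  obtain ⟨φ', hφ', hadj⟩ := exists_adjoint_test (E₀ := E₀) (Eₘ := Eₘ) hG.isOpen hφ α.exps
  -- The statement that u_α is the weak derivative of u₀, tested against φ, is closed under limits
  -- and holds for jets of smooth functions by integration by parts.
  have hcl : IsClosed {u : L2Jet m G E₀ Eₘ | ∫ z, u α z * φ z ∂(phaseMeasure G E₀ Eₘ) =
      ∫ z, u (zeroIndex m) z * φ' z ∂(phaseMeasure G E₀ Eₘ)} :=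
    isClosed_eq
      ((continuous_integral_mul (memLp_of_isCxCompact (hφ.isCxCompact 0))).comp
        (PiLp.continuous_apply 2 _ α))
      ((continuous_integral_mul (memLp_of_isCxCompact hφ')).comp
        (PiLp.continuous_apply 2 _ (zeroIndex m)))
  have hmem := closure_minimal (s := {u | ∃ ψ ∈ smoothSpace G E₀ Eₘ, IsL2Jet ψ u}) ?_ hcl hu
  · rw [mem_ofPred_eq, h0] at hmem
    rw [hmem]
    refine integral_eq_zero_of_ae ?_
    filter_upwards [Lp.coeFn_zero ℝ 2 (phaseMeasure G E₀ Eₘ)] with z hz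
    simp only [hz, Pi.zero_apply, zero_mul]
  · rintro u ⟨ψ, hψ, hu⟩
    have h1 : ∫ z, u α z * φ z ∂(phaseMeasure G E₀ Eₘ) =
        ∫ z, pdMulti α.exps ψ z * φ z ∂(phaseMeasure G E₀ Eₘ) :=
      integral_congr_ae (by filter_upwards [hu α] with z hz; rw [hz])
    have h2 : ∫ z, u (zeroIndex m) z * φ' z ∂(phaseMeasure G E₀ Eₘ) =
        ∫ z, ψ z * φ' z ∂(phaseMeasure G E₀ Eₘ) :=
      integral_congr_ae (by filter_upwards [hu (zeroIndex m)] with z hz; rw [hz]; rfl)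
    rw [mem_ofPred_eq, h1, h2, hadj ψ hψ]

theorem eq_of_apply_zeroIndex (hG : IsSmoothStrictlyConvexDomain G) {u v : L2Jet m G E₀ Eₘ}
    (hu : u ∈ H0 m G E₀ Eₘ) (hv : v ∈ H0 m G E₀ Eₘ) (h0 : u (zeroIndex m) = v (zeroIndex m)) :
    u = v := by
  have := eq_zero_of_apply_zeroIndex hG (u := u - v) ((H0Submodule hG.isOpen).sub_mem hu hv)
    (by rw [PiLp.sub_apply, h0, sub_self])
  exact sub_eq_zero.1 this

/-- Green's formula for smooth functions that vanish near the inflow boundary and test functions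
that vanish near the outflow boundary. -/
theorem integral_advect_mul (hG : IsSmoothStrictlyConvexDomain G) {ψ φ : Phase → ℝ}
    (hψ : ψ ∈ smoothSpace G E₀ Eₘ) (hφ : IsCxCompact 1 φ)
    (hφd : Disjoint (phaseSupport G E₀ Eₘ φ) (gammaPlusZero G E₀ Eₘ)) :
    ∫ z, advect ψ z * φ z ∂(phaseMeasure G E₀ Eₘ) =
      -∫ z, ψ z * advect φ z ∂(phaseMeasure G E₀ Eₘ) := by
  obtain ⟨⟨f, hf, hψf⟩, hψd⟩ := hψ 1 le_rfl
  set L := phaseSupport G E₀ Eₘ fun z => ψ z * φ z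
  have hLψ : L ⊆ phaseSupport G E₀ Eₘ ψ := closure_mono fun z hz =>
    ⟨left_ne_zero_of_mul hz.1, hz.2⟩
  have hLφ : L ⊆ phaseSupport G E₀ Eₘ φ := closure_mono fun z hz =>
    ⟨right_ne_zero_of_mul hz.1, hz.2⟩
  have hU : IsOpen {z : Phase | z.1 ∈ G} := hG.isOpen.preimage continuous_fst
  -- Every boundary point belongs to Γ₋ ∪ Γ₀, avoided by ψ, or to Γ₊ ∪ Γ₀, avoided by φ. Hence the
  -- support of ψφ stays over G and no boundary term arises.
  have hLU : L ⊆ {z : Phase | z.1 ∈ G} := by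
    intro z hz
    by_contra hout
    have hz' := phaseSupport_subset hz
    have hfr : z.1 ∈ frontier G := by
      rw [hG.isOpen.frontier_eq]; exact ⟨hz'.1, hout⟩
    obtain ⟨n, hn⟩ := hG.exists_outwardNormal hfr
    rcases le_total (inner ℝ (z.2.1 : V3) n) 0 with h | h
    · exact Set.disjoint_left.1 hψd (hLψ hz) ⟨hfr, hz'.2.2, n, hn, h⟩
    · exact Set.disjoint_left.1 hφd (hLφ hz) ⟨hfr, hz'.2.2, n, hn, h⟩
  obtain ⟨V, hV, hLV, hVU⟩ := normal_exists_closure_subset isClosed_closure hU hLU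
  obtain ⟨χ, hχ, h1, h0⟩ := exists_cutoff isClosed_closure hV.isClosed_compl
    (disjoint_compl_right_iff_subset.2 hLV)
  have hfφ : IsCxCompact 1 (fun z => f z * φ z) := IsCxCompact.mul_left hf.1 hφ
  have hΘ := integral_dirDeriv_phase_eq_zero (G := G) E₀ Eₘ continuous_direction
    (IsCxCompact.mul_left (hχ 1) hfφ) fun z hz => hVU <| closure_mono (fun z hz => by
      by_contra h
      exact hz (by simp [h0 z h])) hz
  rw [dirDeriv_direction] at hΘ
  have heq : EqOn (advect fun z => χ z * (f z * φ z))
      (fun z => advect ψ z * φ z + ψ z * advect φ z) (phaseInterior G E₀ Eₘ) := by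
    have e1 : EqOn (fun z => χ z * (f z * φ z)) (fun z => f z * φ z) (phaseInterior G E₀ Eₘ) := by
      intro z hz
      by_cases hz0 : ψ z * φ z = 0
      · simp only [← hψf hz, hz0, mul_zero]
      · simp only [h1 z (subset_closure ⟨hz0, hz⟩), one_mul]
    intro z hz
    rw [advect_congr (isOpen_phaseInterior hG.isOpen _ _) e1 hz, advect_mul hf.1 hφ.1]
    simp only [advect_congr (isOpen_phaseInterior hG.isOpen _ _) hψf hz, hψf hz]
  rw [integral_congr_phaseInterior hG.isOpen heq, integral_add] at hΘ
  · linarith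
  · exact (memLp_of_mem_smoothSpace hG.isOpen (smoothSpace_advect hG.isOpen hψ)).integrable_mul
      (memLp_of_isCxCompact (hφ.mono zero_le_one))
  · exact (memLp_of_mem_smoothSpace hG.isOpen hψ).integrable_mul (memLp_of_isCxCompact hφ.advect)

/-! ### The closed streaming operator -/

/-- The graph of the streaming operator `ω · ∇ₓ` on jets of smooth functions that vanish near the
inflow boundary. -/
def streamGraph (hG : IsOpen G) : Submodule ℝ (L2Jet m G E₀ Eₘ × L2Jet m G E₀ Eₘ) where
  carrier := {p | ∃ ψ ∈ smoothSpace G E₀ Eₘ, IsL2Jet ψ p.1 ∧ IsL2Jet (advect ψ) p.2}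
  add_mem' := by
    rintro p q ⟨ψ, hψ, h1, h2⟩ ⟨ψ', hψ', h1', h2'⟩
    have ha := smoothSpace_advect hG hψ
    have ha' := smoothSpace_advect hG hψ'
    refine ⟨_, smoothSpace_add hψ hψ', h1.add hG hψ hψ' h1',
      (h2.add hG ha ha' h2').congr hG (smoothSpace_add ha ha') fun z hz => ?_⟩
    obtain ⟨g, hg⟩ := hasGerm_of_mem_smoothSpace hG hψ hz
    obtain ⟨g', hg'⟩ := hasGerm_of_mem_smoothSpace hG hψ' hz
    refine (hg.add hg').advect.eq.trans ((hg.advect.add hg'.advect).eq.trans ?_).symm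
    simp only [map_add, smul_add, Finset.sum_add_distrib]
  zero_mem' := ⟨_, smoothSpace_zero, IsL2Jet.zero hG, (IsL2Jet.zero hG).congr hG smoothSpace_zero
    fun z _ => by
      simp only [advect]
      exact Finset.sum_eq_zero fun i _ => by
        rw [show pd i (fun _ => 0) z = 0 from (hasLineDerivAt_const 0 _ _).lineDeriv, mul_zero]⟩
  smul_mem' := by
    rintro c p ⟨ψ, hψ, h1, h2⟩
    have ha := smoothSpace_advect hG hψ
    refine ⟨_, smoothSpace_const_mul hψ c, h1.smul hG hψ c,
      (h2.smul hG ha c).congr hG (smoothSpace_const_mul ha c) fun z hz => ?_⟩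
    obtain ⟨g, hg⟩ := hasGerm_of_mem_smoothSpace hG hψ hz
    refine (hg.const_mul c).advect.eq.trans ((hg.advect.const_mul c).eq.trans ?_).symm
    simp only [map_smul, Finset.smul_sum, smul_comm c]

/-- The graph of the closure of the streaming operator. -/
def closedStreamGraph (hG : IsOpen G) : Submodule ℝ (L2Jet m G E₀ Eₘ × L2Jet m G E₀ Eₘ) :=
  (streamGraph hG).topologicalClosure

theorem isClosed_closedStreamGraph (hG : IsOpen G) :
    IsClosed (closedStreamGraph (m := m) (E₀ := E₀) (Eₘ := Eₘ) hG :
      Set (L2Jet m G E₀ Eₘ × L2Jet m G E₀ Eₘ)) :=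
  Submodule.isClosed_topologicalClosure _

theorem closedStreamGraph_induction {hG : IsOpen G}
    {S : Set (L2Jet m G E₀ Eₘ × L2Jet m G E₀ Eₘ)} (hS : IsClosed S)
    (h : ∀ ψ ∈ smoothSpace G E₀ Eₘ, ∀ p : L2Jet m G E₀ Eₘ × L2Jet m G E₀ Eₘ, IsL2Jet ψ p.1 →
      IsL2Jet (advect ψ) p.2 → p ∈ S)
    {p : L2Jet m G E₀ Eₘ × L2Jet m G E₀ Eₘ} (hp : p ∈ closedStreamGraph hG) : p ∈ S :=
  closure_minimal (s := {p | ∃ ψ ∈ smoothSpace G E₀ Eₘ, IsL2Jet ψ p.1 ∧ IsL2Jet (advect ψ) p.2})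
    (fun p ⟨ψ, hψ, h1, h2⟩ => h ψ hψ p h1 h2) hS hp

theorem mem_H0_of_mem_closedStreamGraph {hG : IsOpen G}
    {p : L2Jet m G E₀ Eₘ × L2Jet m G E₀ Eₘ} (hp : p ∈ closedStreamGraph hG) :
    p.1 ∈ H0 m G E₀ Eₘ ∧ p.2 ∈ H0 m G E₀ Eₘ :=
  closedStreamGraph_induction (S := H0 m G E₀ Eₘ ×ˢ H0 m G E₀ Eₘ)
    (isClosed_closure.prod isClosed_closure)
    (fun ψ hψ _ h1 h2 => ⟨subset_closure ⟨ψ, hψ, h1⟩,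
      subset_closure ⟨_, smoothSpace_advect hG hψ, h2⟩⟩) hp

theorem integral_smoothSpace_mul_advect_nonneg (hG : IsSmoothStrictlyConvexDomain G)
    {ψ : Phase → ℝ} (hψ : ψ ∈ smoothSpace G E₀ Eₘ) :
    0 ≤ ∫ z, ψ z * advect ψ z ∂(phaseMeasure G E₀ Eₘ) := by
  obtain ⟨f, hf, hψf, h0⟩ := (hψ 1 le_rfl).exists_extension hG
  have h := integral_mul_advect_nonneg hG.isOpen E₀ Eₘ hf h0
  rwa [integral_congr_phaseInterior hG.isOpen (fun z hz => by
    simp only [hψf hz, advect_congr (isOpen_phaseInterior hG.isOpen _ _) hψf hz] :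
      EqOn (fun z => ψ z * advect ψ z) (fun z => f z * advect f z) _)]

theorem isClosed_inner_nonneg (X : Type*) [NormedAddCommGroup X] [InnerProductSpace ℝ X] :
    IsClosed {p : X × X | 0 ≤ inner ℝ p.2 p.1} :=
  isClosed_le continuous_const (continuous_snd.inner continuous_fst)

/-- The closed streaming operator is accretive. -/
theorem inner_nonneg_of_mem_closedStreamGraph (hG : IsSmoothStrictlyConvexDomain G)
    {p : L2Jet m G E₀ Eₘ × L2Jet m G E₀ Eₘ} (hp : p ∈ closedStreamGraph hG.isOpen) :
    0 ≤ inner ℝ p.2 p.1 := by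
  refine closedStreamGraph_induction (isClosed_inner_nonneg (L2Jet m G E₀ Eₘ)) ?_ hp
  intro ψ hψ p h1 h2
  rw [mem_ofPred_eq, PiLp.inner_apply]
  refine Finset.sum_nonneg fun α _ => ?_
  -- The scalar inequality applies to each ∂ₓ^α ψ, because derivatives of elements of 𝒟 are again in
  -- 𝒟; summing over α gives the inner product of jets.
  have h := integral_smoothSpace_mul_advect_nonneg hG (smoothSpace_pdMulti hG.isOpen hψ α.exps)
  rw [L2.inner_def]
  refine h.trans_eq (integral_congr_ae ?_)
  filter_upwards [h1 α, h2 α, ae_mem_phaseInterior hG.isOpen E₀ Eₘ] with z e1 e2 hz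
  obtain ⟨g, hg⟩ := hasGerm_of_mem_smoothSpace hG.isOpen hψ hz
  rw [e1, e2, hg.pdMulti_advect]
  simp

theorem integral_mul_of_mem_closedStreamGraph (hG : IsSmoothStrictlyConvexDomain G)
    {p : L2Jet m G E₀ Eₘ × L2Jet m G E₀ Eₘ} (hp : p ∈ closedStreamGraph hG.isOpen)
    {φ : Phase → ℝ} (hφ : IsCxCompact 1 φ)
    (hφd : Disjoint (phaseSupport G E₀ Eₘ φ) (gammaPlusZero G E₀ Eₘ)) :
    ∫ z, p.2 (zeroIndex m) z * φ z ∂(phaseMeasure G E₀ Eₘ) =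
      -∫ z, p.1 (zeroIndex m) z * advect φ z ∂(phaseMeasure G E₀ Eₘ) := by
  refine closedStreamGraph_induction
    (S := {p | ∫ z, p.2 (zeroIndex m) z * φ z ∂(phaseMeasure G E₀ Eₘ) =
      -∫ z, p.1 (zeroIndex m) z * advect φ z ∂(phaseMeasure G E₀ Eₘ)})
    (isClosed_eq ?_ ?_) ?_ hp
  · exact (continuous_integral_mul (memLp_of_isCxCompact (hφ.mono zero_le_one))).comp
      ((PiLp.continuous_apply 2 _ (zeroIndex m)).comp continuous_snd)
  · exact ((continuous_integral_mul (memLp_of_isCxCompact hφ.advect)).comp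
      ((PiLp.continuous_apply 2 _ (zeroIndex m)).comp continuous_fst)).neg
  · intro ψ hψ p h1 h2
    have e1 : ∫ z, p.2 (zeroIndex m) z * φ z ∂(phaseMeasure G E₀ Eₘ) =
        ∫ z, advect ψ z * φ z ∂(phaseMeasure G E₀ Eₘ) :=
      integral_congr_ae (by filter_upwards [h2 (zeroIndex m)] with z hz; rw [hz]; rfl)
    have e2 : ∫ z, p.1 (zeroIndex m) z * advect φ z ∂(phaseMeasure G E₀ Eₘ) =
        ∫ z, ψ z * advect φ z ∂(phaseMeasure G E₀ Eₘ) :=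
      integral_congr_ae (by filter_upwards [h1 (zeroIndex m)] with z hz; rw [hz]; rfl)
    rw [mem_ofPred_eq, e1, e2, integral_advect_mul hG hψ hφ hφd]

/-- The closure of the streaming operator is single-valued. -/
theorem eq_zero_of_mem_closedStreamGraph (hG : IsSmoothStrictlyConvexDomain G)
    {w : L2Jet m G E₀ Eₘ} (hw : (0, w) ∈ closedStreamGraph (m := m) (E₀ := E₀) (Eₘ := Eₘ) hG.isOpen) :
    w = 0 := by
  refine eq_zero_of_apply_zeroIndex hG (mem_H0_of_mem_closedStreamGraph hw).2
    (eq_zero_of_integral_test_eq_zero hG _ fun φ hφ => ?_)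
  have hd : Disjoint (phaseSupport G E₀ Eₘ φ) (gammaPlusZero G E₀ Eₘ) := by
    rw [Set.disjoint_left]
    intro z hz hz'
    have h1 : z.1 ∈ G := hφ.tsupport_subset z (closure_mono inter_subset_left hz)
    have h2 := hz'.1
    rw [hG.isOpen.frontier_eq] at h2
    exact h2.2 h1
  rw [integral_mul_of_mem_closedStreamGraph hG hw (hφ.isCxCompact 1) hd, neg_eq_zero]
  refine integral_eq_zero_of_ae ?_
  filter_upwards [Lp.coeFn_zero ℝ 2 (phaseMeasure G E₀ Eₘ)] with z hz
  simp only [PiLp.zero_apply, hz, Pi.zero_apply, zero_mul]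

/-- Pairing w + Cu with u and applying Cauchy–Schwarz turns accretivity into a lower bound. -/
theorem norm_le_of_inner_nonneg {X : Type*} [NormedAddCommGroup X] [InnerProductSpace ℝ X]
    {u w : X} {C : ℝ} (h : 0 ≤ inner ℝ w u) : C * ‖u‖ ≤ ‖w + C • u‖ := by
  have h1 : inner ℝ (w + C • u) u = inner ℝ w u + C * ‖u‖ ^ 2 := by
    rw [inner_add_left, real_inner_smul_left, real_inner_self_eq_norm_sq]
  have h2 := real_inner_le_norm (w + C • u) u
  rcases (norm_nonneg u).eq_or_lt with h0 | h0
  · rw [← h0, mul_zero]; exact norm_nonneg _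
  · refine le_of_mul_le_mul_right ?_ h0
    nlinarith

/-- The range of the closed streaming operator plus a positive constant. -/
theorem exists_mem_closedStreamGraph (hG : IsSmoothStrictlyConvexDomain G) {C : ℝ} (hC : 0 < C)
    {f : L2Jet m G E₀ Eₘ} (hf : f ∈ H0 m G E₀ Eₘ) :
    ∃ u, (u, f - C • u) ∈ closedStreamGraph (m := m) (E₀ := E₀) (Eₘ := Eₘ) hG.isOpen := by
  set A := closedStreamGraph (m := m) (E₀ := E₀) (Eₘ := Eₘ) hG.isOpen
  have : CompleteSpace A := (isClosed_closedStreamGraph hG.isOpen).completeSpace_coe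
  let T : A →L[ℝ] L2Jet m G E₀ Eₘ :=
    (ContinuousLinearMap.snd ℝ (L2Jet m G E₀ Eₘ) (L2Jet m G E₀ Eₘ) +
      C • ContinuousLinearMap.fst ℝ (L2Jet m G E₀ Eₘ) (L2Jet m G E₀ Eₘ)).comp A.subtypeL
  have hT : ∀ p : A, T p = p.1.2 + C • p.1.1 := fun p => rfl
  -- For p = (u, w), ‖u‖ ≤ C⁻¹‖T p‖ and ‖w‖ ≤ ‖T p‖ + C‖u‖ ≤ 2‖T p‖. The graph carries the maximum
  -- norm, and the sum of the two constants dominates both.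
  have hanti : AntilipschitzWith (Real.toNNReal (C⁻¹ + 2)) T := by
    refine ContinuousLinearMap.antilipschitz_of_bound T fun p => ?_
    rw [Real.coe_toNNReal _ (by positivity)]
    have h1 : C * ‖p.1.1‖ ≤ ‖T p‖ :=
      norm_le_of_inner_nonneg (inner_nonneg_of_mem_closedStreamGraph hG p.2)
    have h2 : ‖p.1.1‖ ≤ C⁻¹ * ‖T p‖ := by
      rw [← div_eq_inv_mul, le_div_iff₀ hC, mul_comm]; exact h1
    have h3 : ‖p.1.2‖ ≤ 2 * ‖T p‖ := by
      have : p.1.2 = T p - C • p.1.1 := by rw [hT]; abel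
      rw [this]
      refine (norm_sub_le _ _).trans ?_
      rw [norm_smul, Real.norm_of_nonneg hC.le]
      linarith
    have h4 : 0 ≤ C⁻¹ * ‖T p‖ := by positivity
    have h5 := norm_nonneg (T p)
    change max ‖p.1.1‖ ‖p.1.2‖ ≤ _
    rw [add_mul]
    exact max_le (by linarith) (by linarith)
  have hcl := hanti.isClosed_range T.uniformContinuous
  have hmem : f ∈ range T := by
    refine closure_minimal ?_ hcl hf
    rintro f ⟨χ, hχ, hf⟩
    obtain ⟨ψ, hψ, heq⟩ := exists_smooth_solution hG hC hχ
    obtain ⟨u, hu⟩ := exists_isL2Jet (m := m) hG.isOpen hψ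
    have ha := smoothSpace_advect hG.isOpen hψ
    obtain ⟨w, hw⟩ := exists_isL2Jet (m := m) hG.isOpen ha
    refine ⟨⟨(u, w), subset_closure ⟨ψ, hψ, hu, hw⟩⟩, ?_⟩
    rw [hT]
    exact ((hw.add hG.isOpen ha (smoothSpace_const_mul hψ C) (hu.smul hG.isOpen hψ C))).unique
      (hf.congr hG.isOpen hχ heq)
  obtain ⟨p, rfl⟩ := hmem
  refine ⟨p.1.1, ?_⟩
  rw [hT, add_sub_cancel_right]
  exact p.2

/-! ### The transport operator -/

/-- The shear `(u, w) ↦ (u, w + Σ u)` on pairs of jets. -/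
def shear (s : LinftyJet m G E₀ Eₘ) :
    (L2Jet m G E₀ Eₘ × L2Jet m G E₀ Eₘ) ≃ₜ (L2Jet m G E₀ Eₘ × L2Jet m G E₀ Eₘ) where
  toFun p := (p.1, p.2 + jetMul s p.1)
  invFun p := (p.1, p.2 - jetMul s p.1)
  left_inv p := by simp
  right_inv p := by simp
  continuous_toFun :=
    continuous_fst.prodMk (continuous_snd.add ((jetMul s).continuous.comp continuous_fst))
  continuous_invFun :=
    continuous_fst.prodMk (continuous_snd.sub ((jetMul s).continuous.comp continuous_fst))

theorem coeFn_add_jetMul_zeroIndex {ψ : Phase → ℝ} {u w : L2Jet m G E₀ Eₘ}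
    (s : LinftyJet m G E₀ Eₘ) (hu : IsL2Jet ψ u) (hw : IsL2Jet (advect ψ) w) :
    (w + jetMul s u) (zeroIndex m) =ᵐ[phaseMeasure G E₀ Eₘ]
      fun z => advect ψ z + s (zeroIndex m) z * ψ z := by
  filter_upwards [hu (zeroIndex m), hw (zeroIndex m), coeFn_jetMul_zero s u,
    Lp.coeFn_add (w (zeroIndex m)) (jetMul s u (zeroIndex m))] with z h1 h2 h3 h4
  rw [PiLp.add_apply, h4, Pi.add_apply, h3, h1, h2]
  rfl

theorem shear_mem_transportGraph (hG : IsOpen G) {s : LinftyJet m G E₀ Eₘ}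
    (hs : s ∈ coeffSpace m G E₀ Eₘ) {ψ : Phase → ℝ} (hψ : ψ ∈ smoothSpace G E₀ Eₘ)
    {u w : L2Jet m G E₀ Eₘ} (hu : IsL2Jet ψ u) (hw : IsL2Jet (advect ψ) w) :
    (u, w + jetMul s u) ∈ transportGraph s :=
  ⟨ψ, hψ, hu, (H0Submodule hG).add_mem (subset_closure ⟨_, smoothSpace_advect hG hψ, hw⟩)
    (jetMul_mem_H0 hG hs (subset_closure ⟨ψ, hψ, hu⟩)), coeFn_add_jetMul_zeroIndex s hu hw⟩

/-- The graph of P_m prescribes only the component of index zero of its value. Membership in H₀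
fixes the others, so the value is exactly the jet of ω·∇ₓψ plus `jetMul s u`. -/
theorem transportGraph_eq_image (hG : IsSmoothStrictlyConvexDomain G) {s : LinftyJet m G E₀ Eₘ}
    (hs : s ∈ coeffSpace m G E₀ Eₘ) : transportGraph s = 
      shear s '' (streamGraph hG.isOpen : Submodule ℝ (L2Jet m G E₀ Eₘ × L2Jet m G E₀ Eₘ)) := by
  ext p
  constructor
  · rintro ⟨ψ, hψ, hu, hp, heq⟩
    obtain ⟨w, hw⟩ := exists_isL2Jet (m := m) hG.isOpen (smoothSpace_advect hG.isOpen hψ)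
    refine ⟨(p.1, w), ⟨ψ, hψ, hu, hw⟩, Prod.ext rfl ?_⟩
    obtain ⟨-, -, -, hmem, heq'⟩ := shear_mem_transportGraph hG.isOpen hs hψ hu hw
    refine eq_of_apply_zeroIndex hG hmem hp (Lp.ext ?_)
    exact (coeFn_add_jetMul_zeroIndex s hu hw).trans heq.symm
  · rintro ⟨⟨u, w⟩, ⟨ψ, hψ, hu, hw⟩, rfl⟩
    exact shear_mem_transportGraph hG.isOpen hs hψ hu hw

theorem mem_closedTransportGraph_iff (hG : IsSmoothStrictlyConvexDomain G)
    {s : LinftyJet m G E₀ Eₘ} (hs : s ∈ coeffSpace m G E₀ Eₘ) {u g : L2Jet m G E₀ Eₘ} :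
    (u, g) ∈ closedTransportGraph s ↔ (u, g - jetMul s u) ∈ closedStreamGraph hG.isOpen := by
  rw [closedTransportGraph, transportGraph_eq_image hG hs, ← (shear s).image_closure,
    Homeomorph.image_eq_preimage_symm]
  rfl

/-- The product supplied by the bound agrees with `jetMul s u` in the component of index zero, hence
entirely. So any admissible c may replace the crude Leibniz constant. -/
theorem norm_jetMul_le_of_multiplicationBound (hG : IsSmoothStrictlyConvexDomain G) {c : ℝ}
    (hc : MultiplicationBound m G E₀ Eₘ c) {s : LinftyJet m G E₀ Eₘ}
    (hs : s ∈ coeffSpace m G E₀ Eₘ) {u : L2Jet m G E₀ Eₘ} (hu : u ∈ H0 m G E₀ Eₘ) :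
    ‖jetMul s u‖ ≤ c * ‖s‖ * ‖u‖ := by
  obtain ⟨g, hg, heq, hle⟩ := hc s hs u hu
  have : jetMul s u = g := eq_of_apply_zeroIndex hG (jetMul_mem_H0 hG.isOpen hs hu) hg
    (Lp.ext ((coeFn_jetMul_zero s u).trans heq.symm))
  rwa [this]

/-- Uniqueness for the equation `ω · ∇ₓ u + Σ u + C u = 0`. -/
theorem eq_zero_of_homogeneous (hG : IsSmoothStrictlyConvexDomain G) {c C : ℝ}
    (hc : MultiplicationBound m G E₀ Eₘ c) {s : LinftyJet m G E₀ Eₘ}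
    (hs : s ∈ coeffSpace m G E₀ Eₘ) (hC : c * ‖s‖ < C) {u : L2Jet m G E₀ Eₘ}
    (hu : (u, -(C • u) - jetMul s u) ∈
      closedStreamGraph (m := m) (E₀ := E₀) (Eₘ := Eₘ) hG.isOpen) : u = 0 := by
  have h1 := norm_le_of_inner_nonneg (C := C) (inner_nonneg_of_mem_closedStreamGraph hG hu)
  have h2 := norm_jetMul_le_of_multiplicationBound hG hc hs (mem_H0_of_mem_closedStreamGraph hu).1
  have h3 : -(C • u) - jetMul s u + C • u = -jetMul s u := by abel
  simp only [h3, norm_neg] at h1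
  -- Accretivity gives C‖u‖ ≤ ‖Σu‖ ≤ c‖Σ‖‖u‖, which is impossible for u ≠ 0 when c‖Σ‖ < C.
  by_contra h0
  have h4 : 0 < ‖u‖ := norm_pos_iff.2 h0
  simp only at h2
  nlinarith

/-- Existence for the equation `ω · ∇ₓ u + Σ u + C u = f`. -/
theorem exists_solution (hG : IsSmoothStrictlyConvexDomain G) {c C : ℝ} (hc0 : 0 < c)
    (hc : MultiplicationBound m G E₀ Eₘ c) {s : LinftyJet m G E₀ Eₘ}
    (hs : s ∈ coeffSpace m G E₀ Eₘ) (hC : c * ‖s‖ < C) {f : L2Jet m G E₀ Eₘ}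
    (hf : f ∈ H0 m G E₀ Eₘ) :
    ∃ u, (u, f - C • u - jetMul s u) ∈
      closedStreamGraph (m := m) (E₀ := E₀) (Eₘ := Eₘ) hG.isOpen := by
  have hC0 : 0 < C := lt_of_le_of_lt (by positivity) hC
  set A := closedStreamGraph (m := m) (E₀ := E₀) (Eₘ := Eₘ) hG.isOpen
  set H := H0Submodule (m := m) (E₀ := E₀) (Eₘ := Eₘ) hG.isOpen
  have : CompleteSpace H := (isClosed_closure (s := _)).completeSpace_coe
  -- R is the resolvent of the closed streaming operator at C. The difference of two graph points is
  -- again a graph point, which yields the Lipschitz constant 1/C.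
  choose R hR using fun f : H => exists_mem_closedStreamGraph hG hC0 f.2
  have hRH : ∀ f, R f ∈ H := fun f => (mem_H0_of_mem_closedStreamGraph (hR f)).1
  have hlip : ∀ f f' : H, C * ‖R f - R f'‖ ≤ ‖(f : L2Jet m G E₀ Eₘ) - f'‖ := fun f f' => by
    have h1 := norm_le_of_inner_nonneg (C := C)
      (inner_nonneg_of_mem_closedStreamGraph hG (A.sub_mem (hR f) (hR f')))
    have h2 : ((f : L2Jet m G E₀ Eₘ) - C • R f - (f' - C • R f')) + C • (R f - R f') =
        (f : L2Jet m G E₀ Eₘ) - f' := by module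
    simp only [Prod.fst_sub, Prod.snd_sub, h2] at h1
    exact h1
  have hsub : ∀ u : H, f - jetMul s u ∈ H := fun u =>
    H.sub_mem hf (jetMul_mem_H0 hG.isOpen hs u.2)
  -- A fixed point u = R(f - Σu) is a solution, and the contraction constant is c‖Σ‖/C.
  let Φ : H → H := fun u => ⟨R ⟨f - jetMul s u, hsub u⟩, hRH _⟩
  have hK : 0 ≤ c * ‖s‖ / C := by positivity
  have hΦ : ContractingWith (Real.toNNReal (c * ‖s‖ / C)) Φ := by
    refine ⟨?_, LipschitzWith.of_dist_le_mul fun u u' => ?_⟩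
    · rw [← NNReal.coe_lt_coe, Real.coe_toNNReal _ hK, NNReal.coe_one, div_lt_one hC0]
      exact hC
    · rw [Real.coe_toNNReal _ hK, dist_eq_norm, dist_eq_norm]
      have h1 := hlip ⟨f - jetMul s u, hsub u⟩ ⟨f - jetMul s u', hsub u'⟩
      have h2 := norm_jetMul_le_of_multiplicationBound hG hc hs (H.sub_mem u.2 u'.2)
      have h3 : f - jetMul s (u : L2Jet m G E₀ Eₘ) - (f - jetMul s (u' : L2Jet m G E₀ Eₘ)) =
          -jetMul s ((u : L2Jet m G E₀ Eₘ) - u') := by rw [map_sub]; abel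
      simp only [h3, norm_neg] at h1
      change ‖R ⟨f - jetMul s u, hsub u⟩ - R ⟨f - jetMul s u', hsub u'⟩‖ ≤
        _ * ‖(u : L2Jet m G E₀ Eₘ) - u'‖
      rw [div_mul_eq_mul_div, le_div_iff₀ hC0, mul_comm]
      exact h1.trans h2
  set u := ContractingWith.fixedPoint Φ hΦ
  have hu : Φ u = u := hΦ.fixedPoint_isFixedPt
  have hu' : R ⟨f - jetMul s u, hsub u⟩ = u := congrArg Subtype.val hu
  refine ⟨u, ?_⟩
  have h := hR ⟨f - jetMul s u, hsub u⟩
  rw [hu'] at h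
  rwa [sub_right_comm]

/-- The Leibniz constant is a sum of products of binomial coefficients over multi-indices, so it
depends on m only. The added 1 makes positivity immediate. -/
theorem multiplicationBound_leibnizConst (hG : IsOpen G) (m : ℕ) (E₀ Eₘ : ℝ) :
    MultiplicationBound m G E₀ Eₘ (leibnizConst m + 1) := fun s hs u hu =>
  ⟨jetMul s u, jetMul_mem_H0 hG hs hu, coeFn_jetMul_zero s u, (norm_jetMul_le s u).trans (by
    gcongr
    linarith)⟩

theorem isStrongSolution_iff (hG : IsSmoothStrictlyConvexDomain G)
    {s : LinftyJet m G E₀ Eₘ} (hs : s ∈ coeffSpace m G E₀ Eₘ) {C : ℝ} {f u : L2Jet m G E₀ Eₘ} :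
    IsStrongSolution s C f u ↔ (u, f - C • u - jetMul s u) ∈ closedStreamGraph hG.isOpen :=
  mem_closedTransportGraph_iff hG hs

/-- Strong solutions are weak solutions. -/
theorem IsStrongSolution.solvesInflowProblem (hG : IsSmoothStrictlyConvexDomain G)
    {s : LinftyJet m G E₀ Eₘ} (hs : s ∈ coeffSpace m G E₀ Eₘ) {C : ℝ} {f u : L2Jet m G E₀ Eₘ}
    (hu : IsStrongSolution s C f u) : SolvesInflowProblem s C f u := by
  intro φ hφ hφd
  rw [isStrongSolution_iff hG hs] at hu
  rw [← integral_mul_of_mem_closedStreamGraph hG hu hφ hφd]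
  refine integral_congr_ae ?_
  filter_upwards [coeFn_jetMul_zero s u, Lp.coeFn_smul C (u (zeroIndex m)),
    Lp.coeFn_sub (f (zeroIndex m)) (C • u (zeroIndex m)),
    Lp.coeFn_sub (f (zeroIndex m) - C • u (zeroIndex m)) (jetMul s u (zeroIndex m))]
    with z h1 h2 h3 h4
  rw [PiLp.sub_apply, PiLp.sub_apply, PiLp.smul_apply, h4, Pi.sub_apply, h3, Pi.sub_apply, h2,
    Pi.smul_apply, h1, smul_eq_mul]
  ring

end Transport

end

/-! ### The main theorem -/

theorem theorem3p6 (m : ℕ) :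
    -- a multiplication constant `c(m)` that depends on `m` only exists
    (∃ c : ℝ, 0 < c ∧ ∀ (G : Set Transport.V3) (E₀ Eₘ : ℝ),
      Transport.IsSmoothStrictlyConvexDomain G → 0 ≤ E₀ → E₀ < Eₘ →
        Transport.MultiplicationBound m G E₀ Eₘ c) ∧
    ∀ (G : Set Transport.V3) (E₀ Eₘ : ℝ),
      Transport.IsSmoothStrictlyConvexDomain G → 0 ≤ E₀ → E₀ < Eₘ →
      ∀ s ∈ Transport.coeffSpace m G E₀ Eₘ,
        -- `P_m` is defined on the whole of its domain, and its closure is single-valued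
        (∀ ψ ∈ Transport.smoothSpace G E₀ Eₘ,
          ∃ p ∈ Transport.transportGraph s, Transport.IsL2Jet ψ p.1) ∧
        (∀ u g g' : Transport.L2Jet m G E₀ Eₘ,
          (u, g) ∈ Transport.closedTransportGraph s →
          (u, g') ∈ Transport.closedTransportGraph s → g = g') ∧
        -- the range of the closure plus `C`, and the unique strong solution
        ∀ c : ℝ, 0 < c → Transport.MultiplicationBound m G E₀ Eₘ c →
          ∀ C : ℝ, c * ‖s‖ < C →
            {f | ∃ u g : Transport.L2Jet m G E₀ Eₘ,
              (u, g) ∈ Transport.closedTransportGraph s ∧ f = g + C • u} =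
                Transport.H0 m G E₀ Eₘ ∧
            ∀ f ∈ Transport.H0 m G E₀ Eₘ,
              (∃! u : Transport.L2Jet m G E₀ Eₘ, Transport.IsStrongSolution s C f u) ∧
              ∀ u : Transport.L2Jet m G E₀ Eₘ, Transport.IsStrongSolution s C f u →
                u ∈ Transport.H0 m G E₀ Eₘ ∧ Transport.SolvesInflowProblem s C f u := by
  refine ⟨⟨Transport.leibnizConst m + 1,
    add_pos_of_nonneg_of_pos Transport.leibnizConst_nonneg one_pos, fun G E₀ Eₘ hG _ _ =>
      Transport.multiplicationBound_leibnizConst hG.isOpen m E₀ Eₘ⟩, ?_⟩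
  intro G E₀ Eₘ hG _ _ s hs
  let H := Transport.H0Submodule (m := m) (E₀ := E₀) (Eₘ := Eₘ) hG.isOpen
  let A := Transport.closedStreamGraph (m := m) (E₀ := E₀) (Eₘ := Eₘ) hG.isOpen
  have hA : ∀ {u g : Transport.L2Jet m G E₀ Eₘ},
      (u, g) ∈ Transport.closedTransportGraph s ↔ (u, g - Transport.jetMul s u) ∈ A :=
    Transport.mem_closedTransportGraph_iff hG hs
  refine ⟨fun ψ hψ => ?_, fun u g g' hg hg' => ?_, fun c hc0 hc C hC => ⟨?_, fun f hf => ⟨?_, ?_⟩⟩⟩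
  · obtain ⟨u, hu⟩ := Transport.exists_isL2Jet (m := m) hG.isOpen hψ
    obtain ⟨w, hw⟩ := Transport.exists_isL2Jet (m := m) hG.isOpen
      (Transport.smoothSpace_advect hG.isOpen hψ)
    exact ⟨_, Transport.shear_mem_transportGraph hG.isOpen hs hψ hu hw, hu⟩
  · have h := A.sub_mem (hA.1 hg) (hA.1 hg')
    rw [Prod.mk_sub_mk, sub_self, sub_sub_sub_cancel_right] at h
    exact sub_eq_zero.1 (Transport.eq_zero_of_mem_closedStreamGraph hG h)
  · refine Subset.antisymm ?_ fun f hf => ?_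
    · rintro f ⟨u, g, hug, rfl⟩
      obtain ⟨hu, hw⟩ := Transport.mem_H0_of_mem_closedStreamGraph (hA.1 hug)
      have hg := H.add_mem hw (Transport.jetMul_mem_H0 hG.isOpen hs hu)
      rw [sub_add_cancel] at hg
      exact H.add_mem hg (H.smul_mem C hu)
    · obtain ⟨u, hu⟩ := Transport.exists_solution hG hc0 hc hs hC hf
      exact ⟨u, f - C • u, hA.2 hu, (sub_add_cancel _ _).symm⟩
  · obtain ⟨u, hu⟩ := Transport.exists_solution hG hc0 hc hs hC hf
    refine ⟨u, (Transport.isStrongSolution_iff hG hs).2 hu, fun v hv => sub_eq_zero.1 ?_⟩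
    have h := A.sub_mem ((Transport.isStrongSolution_iff hG hs).1 hv) hu
    refine Transport.eq_zero_of_homogeneous hG hc hs hC ?_
    have e : f - C • v - Transport.jetMul s v - (f - C • u - Transport.jetMul s u) =
        -(C • (v - u)) - Transport.jetMul s (v - u) := by
      rw [map_sub]; module
    rwa [Prod.mk_sub_mk, e] at h
  · exact fun u hu => ⟨(Transport.mem_H0_of_mem_closedStreamGraph
      ((Transport.isStrongSolution_iff hG hs).1 hu)).1, hu.solvesInflowProblem hG hs⟩
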